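/- Let $S_0$ be a nonempty finite set, $\mathbb{H}=\{-1,0,1\}$, $\mathbb{H}_+=\{0,1\}$. Consider a two-dimensional quasi-birth-and-death process (2d-QBD process), i.e. a Markov chain on $\mathbb{Z}_+^2\times S_0$ whose transition probabilities from $(x_1,x_2,\cdot)$ to $(x_1+i,x_2+j,\cdot)$ are given by nonnegative $S_0\times S_0$ matrices: $A_{i,j}$ ($i,j\in\mathbb{H}$) if $x_1,x_2\neq0$; $A^{(1)}_{i,j}$ ($i\in\mathbb{H},j\in\mathbb{H}_+$) if $x_1\ne0=x_2$; $A^{(2)}_{i,j}$ ($i\in\mathbb{H}_+,j\in\mathbb{H}$) if $x_1=0\neq x_2$; $A^{(0)}_{i,j}$ ($i,j\in\mathbb{H}_+$) if $x_1=x_2=0$; other transitions have probability $0$, and the sum of the matrices in each of the four families is stochastic. Assume that the following three chains are irreducible and aperiodic: the chain on $\mathbb{Z}^2\times S_0$ with blocks $A_{i,j}$ everywhere; the chain on $\mathbb{Z}\times\mathbb{Z}_+\times S_0$ with blocks $A_{i,j}$ where $x_2\ne0$ and $A^{(1)}_{i,j}$ where $x_2=0$; and the chain on $\mathbb{Z}_+\times\mathbb{Z}\times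 S_0$ with blocks $A_{i,j}$ where $x_1\neq0$ and $A^{(2)}_{i,j}$ where $x_1=0$. For $z>0$ put $A_{*,j}(z)=\sum_{i\in\mathbb{H}}A_{i,j}z^i$, $A_{i,*}(z)=\sum_{j\in\mathbb{H}}A_{i,j}z^j$, $A^{(1)}_{*,j}(z)=\sum_{i\in\mathbb{H}}A^{(1)}_{i,j}z^i$, $A^{(2)}_{i,*}(z)=\sum_{j\in\mathbb{H}}A^{(2)}_{i,j}z^j$; omit the argument when $z=1$, and let $A_{*,*}=\sum_{i,j\in\mathbb{H}}A_{i,j}$. Let $\boldsymbol{\pi}_{*,*}$ be the stationary distribution of $A_{*,*}$, let $\mathbf{1}$ be the column vector of ones, and let $$a_1^{\{1,2\}}=\boldsymbol{\pi}_{*,*}(-A_{-1,*}+A_{1,*})\mathbf{1},\qquad a_2^{\{1,2\}}=\boldsymbol{\pi}_{*,*}(-A_{*,-1}+A_{*,1})\mathbf{1}.$$ Let $A^{(1)}_*$ be the block tri-diagonal transition matrix on $\mathbb{Z}_+\times S_0$ with blocks $A^{(1)}_{*,0},A^{(1)}_{*,1}$ in block row $0$ and $A_{*,-1},A_{*,0},A_{*,1}$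 in the other block rows, and let $A^{(2)}_*$ be the one with $A^{(2)}_{0,*},A^{(2)}_{1,*}$ in block row $0$ and $A_{-1,*},A_{0,*},A_{1,*}$ in the others. For $m\in\{1,2\}$ let $\boldsymbol{\pi}^{(m)}_*=(\boldsymbol{\pi}^{(m)}_{*,k})_{k\ge0}$ be the stationary distribution of $A^{(m)}_*$, if it exists, and $R^{(m)}_*$ the rate matrix of $A_*^{(m)}$, i.e. the (entrywise) minimum nonnegative solution of $X^2A_{*,-1}+XA_{*,0}+A_{*,1}=X$ for $m=1$ and of $X^2A_{-1,*}+XA_{0,*}+A_{1,*}=X$ for $m=2$. Define the induced drifts $$a_1^{\{1\}}=\boldsymbol{\pi}^{(1)}_{*,0}\big(-A^{(1)}_{-1,0}-A^{(1)}_{-1,1}+A^{(1)}_{1,0}+A^{(1)}_{1,1}\big)\mathbf{1}+\boldsymbol{\pi}^{(1)}_{*,1}(I-R^{(1)}_*)^{-1}(-A_{-1,*}+A_{1,*})\mathbf{1},$$ $$a_2^{\{2\}}=\boldsymbol{\pi}^{(2)}_{*,0}\big(-A^{(2)}_{0,-1}-A^{(2)}_{1,-1}+A^{(2)}_{0,1}+A^{(2)}_{1,1}\big)\mathbf{1}+\boldsymbol{\pi}^{(2)}_{*,1}(I-R^{(2)}_*)^{-1}(-A_{*,-1}+A_{*,1})\mathbf{1}.$$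 Let $G_1(z)$ and $G_2(z)$ be the minimum nonnegative solutions of $A_{*,-1}(z)+A_{*,0}(z)X+A_{*,1}(z)X^2=X$ and $A_{-1,*}(z)+A_{0,*}(z)X+A_{1,*}(z)X^2=X$, respectively, where they exist, and, with $\mathrm{spr}$ the spectral radius, $$\psi_1(z)=\mathrm{spr}\big(A^{(1)}_{*,0}(z)+A^{(1)}_{*,1}(z)G_1(z)\big),\qquad \psi_2(z)=\mathrm{spr}\big(A^{(2)}_{0,*}(z)+A^{(2)}_{1,*}(z)G_2(z)\big).$$ (i) If $a_2^{\{1,2\}}<0$, then $\psi_1$ is differentiable at $1$ and $\psi_1'(1)=c_1\,a_1^{\{1\}}$ for some positive constant $c_1$. (ii) If $a_1^{\{1,2\}}<0$, then $\psi_2$ is differentiable at $1$ and $\psi_2'(1)=c_2\,a_2^{\{2\}}$ for some positive constant $c_2$. -/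

import Mathlib

open scoped Matrix

noncomputable section

/-- The step set `{-1, 0, 1}` of a skip-free coordinate away from its boundary. -/
def stepH : Finset ℤ := {-1, 0, 1}

/-- The step set `{0, 1}` of a skip-free coordinate on its boundary. -/
def stepHPlus : Finset ℤ := {0, 1}

section MarkovChain

variable {X : Type*}

/-- The `n`-step transition probabilities of a transition probability matrix `p` on a (possibly
infinite) state space. -/
def nStep [DecidableEq X] (p : Matrix X X ℝ) : ℕ → Matrix X X ℝ
  | 0 => 1
  | n + 1 => fun x y => ∑' w, p x w * nStep p n w y

/-- Every state can be reached from every state. -/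
def ChainIrreducible [DecidableEq X] (p : Matrix X X ℝ) : Prop :=
  ∀ x y, ∃ n, 0 < nStep p n x y

/-- Every state has period one: the only common divisor of its possible return times is `1`. -/
def ChainAperiodic [DecidableEq X] (p : Matrix X X ℝ) : Prop :=
  ∀ x, ∀ d : ℕ, (∀ n, 0 < n → 0 < nStep p n x x → d ∣ n) → d = 1

/-- `π` is a probability distribution with `π p = π`. -/
def IsStationaryDistribution (p : Matrix X X ℝ) (π : X → ℝ) : Prop :=
  (∀ x, 0 ≤ π x) ∧ HasSum π 1 ∧ ∀ y, HasSum (fun x => π x * p x y) (π y)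

open Classical in
/-- The stationary distribution of `p` if there is one (it is unique when `p` is irreducible);
zero otherwise. -/
def stationaryDistribution (p : Matrix X X ℝ) : X → ℝ :=
  if h : ∃ π, IsStationaryDistribution p π then h.choose else 0

end MarkovChain

section MatrixNotions

variable {S : Type*} [Fintype S] [DecidableEq S]

/-- The maximum modulus of the (complex) eigenvalues of a real square matrix. -/
def spr (M : Matrix S S ℝ) : ℝ :=
  (spectralRadius ℂ (M.map (fun x : ℝ => (x : ℂ)))).toReal

/-- `M` is the entrywise minimum of the entrywise nonnegative matrices satisfying `E`. -/
def IsMinNonnegSolution (E : Matrix S S ℝ → Prop) (M : Matrix S S ℝ) : Prop :=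
  (∀ a b, 0 ≤ M a b) ∧ E M ∧
    ∀ N : Matrix S S ℝ, (∀ a b, 0 ≤ N a b) → E N → ∀ a b, M a b ≤ N a b

open Classical in
/-- The minimum nonnegative solution of `E` if there is one; zero otherwise. -/
def minNonnegSolution (E : Matrix S S ℝ → Prop) : Matrix S S ℝ :=
  if h : ∃ M, IsMinNonnegSolution E M then h.choose else 0

/-- The G-matrix of the triplet `D (-1), D 0, D 1`: the minimum nonnegative solution of
`D₋₁ + D₀ X + D₁ X² = X`. -/
def gMatrix (D : ℤ → Matrix S S ℝ) : Matrix S S ℝ :=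
  minNonnegSolution fun M => D (-1) + D 0 * M + D 1 * M ^ 2 = M

/-- The rate matrix of the triplet `D (-1), D 0, D 1`: the minimum nonnegative solution of
`X² D₋₁ + X D₀ + D₁ = X`. -/
def rateMatrix (D : ℤ → Matrix S S ℝ) : Matrix S S ℝ :=
  minNonnegSolution fun M => M ^ 2 * D (-1) + M * D 0 + D 1 = M

/-- The block tri-diagonal matrix with boundary blocks `B 0, B 1` in block row `0` and with
blocks `D (-1), D 0, D 1` in every other block row. -/
def blockTridiagonal (B D : ℤ → Matrix S S ℝ) : Matrix (ℕ × S) (ℕ × S) ℝ :=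
  fun x y =>
    let δ : ℤ := (y.1 : ℤ) - (x.1 : ℤ)
    if x.1 = 0 then (if δ ∈ stepHPlus then B δ x.2 y.2 else 0)
    else (if δ ∈ stepH then D δ x.2 y.2 else 0)

end MatrixNotions

/-- The transition blocks of a two-dimensional quasi-birth-and-death process with finite phase
set `S`: `A i j` (`i, j ∈ {-1,0,1}`) in the interior of the quadrant, `A₁ i j` (`i ∈ {-1,0,1}`,
`j ∈ {0,1}`) on the axis `x₂ = 0`, `A₂ i j` (`i ∈ {0,1}`, `j ∈ {-1,0,1}`) on the axis `x₁ = 0`,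
and `A₀ i j` (`i, j ∈ {0,1}`) at the origin. Values at other indices are never used. -/
structure TwoDQBD (S : Type*) [Fintype S] [DecidableEq S] where
  A : ℤ → ℤ → Matrix S S ℝ
  A₁ : ℤ → ℤ → Matrix S S ℝ
  A₂ : ℤ → ℤ → Matrix S S ℝ
  A₀ : ℤ → ℤ → Matrix S S ℝ
  A_nonneg : ∀ i ∈ stepH, ∀ j ∈ stepH, ∀ a b, 0 ≤ A i j a b
  A₁_nonneg : ∀ i ∈ stepH, ∀ j ∈ stepHPlus, ∀ a b, 0 ≤ A₁ i j a b
  A₂_nonneg : ∀ i ∈ stepHPlus, ∀ j ∈ stepH, ∀ a b, 0 ≤ A₂ i j a b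
  A₀_nonneg : ∀ i ∈ stepHPlus, ∀ j ∈ stepHPlus, ∀ a b, 0 ≤ A₀ i j a b
  A_stochastic : ∀ a, ∑ b, (∑ i ∈ stepH, ∑ j ∈ stepH, A i j) a b = 1
  A₁_stochastic : ∀ a, ∑ b, (∑ i ∈ stepH, ∑ j ∈ stepHPlus, A₁ i j) a b = 1
  A₂_stochastic : ∀ a, ∑ b, (∑ i ∈ stepHPlus, ∑ j ∈ stepH, A₂ i j) a b = 1
  A₀_stochastic : ∀ a, ∑ b, (∑ i ∈ stepHPlus, ∑ j ∈ stepHPlus, A₀ i j) a b = 1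

namespace TwoDQBD

variable {S : Type*} [Fintype S] [DecidableEq S] (Q : TwoDQBD S)

/-- The transition matrix of the process itself, on `ℤ₊² × S`. -/
def P : Matrix (ℕ × ℕ × S) (ℕ × ℕ × S) ℝ := fun x y =>
  let δ₁ : ℤ := (y.1 : ℤ) - (x.1 : ℤ)
  let δ₂ : ℤ := (y.2.1 : ℤ) - (x.2.1 : ℤ)
  if x.1 ≠ 0 ∧ x.2.1 ≠ 0 then
    (if δ₁ ∈ stepH ∧ δ₂ ∈ stepH then Q.A δ₁ δ₂ x.2.2 y.2.2 else 0)
  else if x.1 ≠ 0 ∧ x.2.1 = 0 then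
    (if δ₁ ∈ stepH ∧ δ₂ ∈ stepHPlus then Q.A₁ δ₁ δ₂ x.2.2 y.2.2 else 0)
  else if x.1 = 0 ∧ x.2.1 ≠ 0 then
    (if δ₁ ∈ stepHPlus ∧ δ₂ ∈ stepH then Q.A₂ δ₁ δ₂ x.2.2 y.2.2 else 0)
  else
    (if δ₁ ∈ stepHPlus ∧ δ₂ ∈ stepHPlus then Q.A₀ δ₁ δ₂ x.2.2 y.2.2 else 0)

/-- The transition matrix on `ℤ² × S` after removing both boundaries. -/
def PTilde : Matrix (ℤ × ℤ × S) (ℤ × ℤ × S) ℝ := fun x y =>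
  let δ₁ : ℤ := y.1 - x.1
  let δ₂ : ℤ := y.2.1 - x.2.1
  if δ₁ ∈ stepH ∧ δ₂ ∈ stepH then Q.A δ₁ δ₂ x.2.2 y.2.2 else 0

/-- The transition matrix on `ℤ × ℤ₊ × S` after removing the boundary on the `x₂`-axis. -/
def PTilde₁ : Matrix (ℤ × ℕ × S) (ℤ × ℕ × S) ℝ := fun x y =>
  let δ₁ : ℤ := y.1 - x.1
  let δ₂ : ℤ := (y.2.1 : ℤ) - (x.2.1 : ℤ)
  if x.2.1 ≠ 0 then
    (if δ₁ ∈ stepH ∧ δ₂ ∈ stepH then Q.A δ₁ δ₂ x.2.2 y.2.2 else 0)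
  else
    (if δ₁ ∈ stepH ∧ δ₂ ∈ stepHPlus then Q.A₁ δ₁ δ₂ x.2.2 y.2.2 else 0)

/-- The transition matrix on `ℤ₊ × ℤ × S` after removing the boundary on the `x₁`-axis. -/
def PTilde₂ : Matrix (ℕ × ℤ × S) (ℕ × ℤ × S) ℝ := fun x y =>
  let δ₁ : ℤ := (y.1 : ℤ) - (x.1 : ℤ)
  let δ₂ : ℤ := y.2.1 - x.2.1
  if x.1 ≠ 0 then
    (if δ₁ ∈ stepH ∧ δ₂ ∈ stepH then Q.A δ₁ δ₂ x.2.2 y.2.2 else 0)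
  else
    (if δ₁ ∈ stepHPlus ∧ δ₂ ∈ stepH then Q.A₂ δ₁ δ₂ x.2.2 y.2.2 else 0)

/-- The three chains obtained by removing one or two boundaries are irreducible and aperiodic. -/
def UnboundedIrreducibleAperiodic : Prop :=
  (ChainIrreducible Q.PTilde ∧ ChainAperiodic Q.PTilde) ∧
  (ChainIrreducible Q.PTilde₁ ∧ ChainAperiodic Q.PTilde₁) ∧
  (ChainIrreducible Q.PTilde₂ ∧ ChainAperiodic Q.PTilde₂)

/-- `A_{*,*}`. -/
def Astar : Matrix S S ℝ := ∑ i ∈ stepH, ∑ j ∈ stepH, Q.A i j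

/-- `A_{*,j}(z) = ∑ i, A_{i,j} zⁱ`; at `z = 1` this is `A_{*,j}`. -/
def colA (z : ℝ) (j : ℤ) : Matrix S S ℝ := ∑ i ∈ stepH, z ^ i • Q.A i j

/-- `A_{i,*}(z) = ∑ j, A_{i,j} zʲ`; at `z = 1` this is `A_{i,*}`. -/
def rowA (z : ℝ) (i : ℤ) : Matrix S S ℝ := ∑ j ∈ stepH, z ^ j • Q.A i j

/-- `A^{(1)}_{*,j}(z) = ∑ i, A^{(1)}_{i,j} zⁱ`; at `z = 1` this is `A^{(1)}_{*,j}`. -/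
def colA₁ (z : ℝ) (j : ℤ) : Matrix S S ℝ := ∑ i ∈ stepH, z ^ i • Q.A₁ i j

/-- `A^{(2)}_{i,*}(z) = ∑ j, A^{(2)}_{i,j} zʲ`; at `z = 1` this is `A^{(2)}_{i,*}`. -/
def rowA₂ (z : ℝ) (i : ℤ) : Matrix S S ℝ := ∑ j ∈ stepH, z ^ j • Q.A₂ i j

/-- `a^{{1,2}}_1 = π_{*,*} (-A_{-1,*} + A_{1,*}) 1`. -/
def drift12₁ : ℝ :=
  stationaryDistribution Q.Astar ⬝ᵥ ((-Q.rowA 1 (-1) + Q.rowA 1 1) *ᵥ 1)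

/-- `a^{{1,2}}_2 = π_{*,*} (-A_{*,-1} + A_{*,1}) 1`. -/
def drift12₂ : ℝ :=
  stationaryDistribution Q.Astar ⬝ᵥ ((-Q.colA 1 (-1) + Q.colA 1 1) *ᵥ 1)

/-- `A^{(1)}_*`, the transition matrix of the induced chain `L^{{1}}` on `ℤ₊ × S`. -/
def inducedChain₁ : Matrix (ℕ × S) (ℕ × S) ℝ := blockTridiagonal (Q.colA₁ 1) (Q.colA 1)

/-- `A^{(2)}_*`, the transition matrix of the induced chain `L^{{2}}` on `ℤ₊ × S`. -/
def inducedChain₂ : Matrix (ℕ × S) (ℕ × S) ℝ := blockTridiagonal (Q.rowA₂ 1) (Q.rowA 1)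

/-- `π^{(1)}_{*,k}`, level `k` of the stationary distribution of `L^{{1}}`. -/
def inducedStationary₁ (k : ℕ) : S → ℝ := fun a => stationaryDistribution Q.inducedChain₁ (k, a)

/-- `π^{(2)}_{*,k}`, level `k` of the stationary distribution of `L^{{2}}`. -/
def inducedStationary₂ (k : ℕ) : S → ℝ := fun a => stationaryDistribution Q.inducedChain₂ (k, a)

/-- `a^{{1}}_1`, the first component of the mean drift derived from `L^{{1}}`
(the second component is zero). -/
def drift1₁ : ℝ :=
  Q.inducedStationary₁ 0 ⬝ᵥ
      ((-Q.A₁ (-1) 0 - Q.A₁ (-1) 1 + Q.A₁ 1 0 + Q.A₁ 1 1) *ᵥ 1) +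
    (Q.inducedStationary₁ 1 ᵥ* (1 - rateMatrix (Q.colA 1))⁻¹) ⬝ᵥ
      ((-Q.rowA 1 (-1) + Q.rowA 1 1) *ᵥ 1)

/-- `a^{{2}}_2`, the second component of the mean drift derived from `L^{{2}}`
(the first component is zero). -/
def drift2₂ : ℝ :=
  Q.inducedStationary₂ 0 ⬝ᵥ
      ((-Q.A₂ 0 (-1) - Q.A₂ 1 (-1) + Q.A₂ 0 1 + Q.A₂ 1 1) *ᵥ 1) +
    (Q.inducedStationary₂ 1 ᵥ* (1 - rateMatrix (Q.rowA 1))⁻¹) ⬝ᵥ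
      ((-Q.colA 1 (-1) + Q.colA 1 1) *ᵥ 1)

/-- `G₁(z)`, the minimum nonnegative solution of
`A_{*,-1}(z) + A_{*,0}(z) X + A_{*,1}(z) X² = X`. -/
def G₁ (z : ℝ) : Matrix S S ℝ := gMatrix (Q.colA z)

/-- `G₂(z)`, the minimum nonnegative solution of
`A_{-1,*}(z) + A_{0,*}(z) X + A_{1,*}(z) X² = X`. -/
def G₂ (z : ℝ) : Matrix S S ℝ := gMatrix (Q.rowA z)

/-- `C₁(z, X) = A^{(1)}_{*,0}(z) + A^{(1)}_{*,1}(z) X`. -/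
def C₁ (z : ℝ) (X : Matrix S S ℝ) : Matrix S S ℝ := Q.colA₁ z 0 + Q.colA₁ z 1 * X

/-- `C₂(X, z) = A^{(2)}_{0,*}(z) + A^{(2)}_{1,*}(z) X`. -/
def C₂ (X : Matrix S S ℝ) (z : ℝ) : Matrix S S ℝ := Q.rowA₂ z 0 + Q.rowA₂ z 1 * X

/-- `ψ₁(z) = spr (C₁(z, G₁(z)))`. -/
def ψ₁ (z : ℝ) : ℝ := spr (Q.C₁ z (Q.G₁ z))

/-- `ψ₂(z) = spr (C₂(G₂(z), z))`. -/
def ψ₂ (z : ℝ) : ℝ := spr (Q.C₂ (Q.G₂ z) z)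

end TwoDQBD

end

/-! Write `D z j` and `B z j` for the interior and boundary blocks, `G` for the G-matrix of `D z`,
`U = D 0 + D 1 * G`, `N = (1 - U)⁻¹` and `K = 1 - D 0 - D 1 - D 1 * G`. The claim concerns the
Perron root of the censored matrix `C(z) = B z 0 + B z 1 * G(z)` near `z = 1`, where `C` is
stochastic.

The Perron root of a matrix family at a stochastic matrix whose right fixed vectors are constant has
derivative `u ⬝ᵥ d`, with `u` the stationary row vector and `d` the derivative of the row sums
(`hasDerivAt_spr`). Only continuity of the family is needed besides, so `G(z)` need only be
continuous (`continuousAt_gMatrix`) with differentiable row sums. The latter follow from the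
identity `K(z) (G(z) 1 - 1) = (∑ j, D z j) 1 - 1`: its right side vanishes at `z = 1` and `K(1)` is
invertible (`hasDerivAt_gMatrix_mulVec_one`).

The negative drift enters through a geometric Lyapunov function `w ^ k * v a` (`StableTriplet`),
obtained by perturbing the constant function with a solution of a Poisson equation. It makes `G`
stochastic, `1 - U` and `K` invertible and the powers of the rate matrix `R` summable, so that
stationary distributions exist and satisfy `π₁ = π₀ B₁ N` (`stationary_form`). Since `K = (1 - R) (1
- U)`, one has `π₀ B₁ K⁻¹ = π₁ (1 - R)⁻¹`, which turns the derivative into the induced drift divided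
by the total mass of `π₀`; that mass gives the positive constant.

Irreducibility supplies maximum principles: fixed vectors of `A_{*,*}` and of `C(1)` are constant.
The second statement is the first for the process with exchanged coordinates. -/

noncomputable section

/-! ### Nonnegative matrices, stationary vectors and the Fredholm alternative -/

section NonnegMatrix

open Filter Topology

theorem one_apply_nonneg {S : Type*} [DecidableEq S] (a b : S) : 0 ≤ (1 : Matrix S S ℝ) a b := by
  rw [Matrix.one_apply]; split_ifs <;> norm_num

variable {S : Type*} [Fintype S]

theorem mulVec_le_mulVec_of_nonneg {M : Matrix S S ℝ} (hM : ∀ a b, 0 ≤ M a b) {v w : S → ℝ}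
    (h : ∀ a, v a ≤ w a) (a : S) : (M *ᵥ v) a ≤ (M *ᵥ w) a :=
  Finset.sum_le_sum fun b _ => mul_le_mul_of_nonneg_left (h b) (hM a b)

theorem mulVec_le_mulVec_of_le {M N : Matrix S S ℝ} (h : ∀ a b, M a b ≤ N a b) {v : S → ℝ}
    (hv : ∀ a, 0 ≤ v a) (a : S) : (M *ᵥ v) a ≤ (N *ᵥ v) a :=
  Finset.sum_le_sum fun b _ => mul_le_mul_of_nonneg_right (h a b) (hv b)

theorem mulVec_apply_nonneg {M : Matrix S S ℝ} (hM : ∀ a b, 0 ≤ M a b) {v : S → ℝ}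
    (hv : ∀ a, 0 ≤ v a) (a : S) : 0 ≤ (M *ᵥ v) a :=
  Finset.sum_nonneg fun b _ => mul_nonneg (hM a b) (hv b)

theorem vecMul_apply_nonneg {M : Matrix S S ℝ} (hM : ∀ a b, 0 ≤ M a b) {v : S → ℝ}
    (hv : ∀ a, 0 ≤ v a) (a : S) : 0 ≤ (v ᵥ* M) a :=
  Finset.sum_nonneg fun b _ => mul_nonneg (hv b) (hM b a)

theorem mul_apply_nonneg {M N : Matrix S S ℝ} (hM : ∀ a b, 0 ≤ M a b) (hN : ∀ a b, 0 ≤ N a b)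
    (a b : S) : 0 ≤ (M * N) a b :=
  Finset.sum_nonneg fun c _ => mul_nonneg (hM a c) (hN c b)

theorem mul_apply_le_mul_apply {M M' N N' : Matrix S S ℝ} (hM : ∀ a b, M a b ≤ M' a b)
    (hN : ∀ a b, N a b ≤ N' a b) (hN0 : ∀ a b, 0 ≤ N a b) (hM0 : ∀ a b, 0 ≤ M' a b)
    (a b : S) : (M * N) a b ≤ (M' * N') a b :=
  Finset.sum_le_sum fun c _ => mul_le_mul (hM a c) (hN c b) (hN0 c b) (hM0 a c)

theorem apply_le_of_mulVec_le {M : Matrix S S ℝ} (hM : ∀ a b, 0 ≤ M a b) {v w : S → ℝ}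
    (hv : ∀ a, 0 < v a) (h : ∀ a, (M *ᵥ v) a ≤ w a) (a b : S) : M a b ≤ w a / v b := by
  rw [le_div_iff₀ (hv b)]
  exact (Finset.single_le_sum (f := fun b => M a b * v b)
    (fun c _ => mul_nonneg (hM a c) (hv c).le) (Finset.mem_univ b)).trans (h a)

/-- A finite positive vector can be dominated by a multiple of another one. -/
theorem exists_le_mul_of_pos [Nonempty S] (x : S → ℝ) {v : S → ℝ} (hv : ∀ a, 0 < v a) :
    ∃ C, 0 < C ∧ ∀ a, |x a| ≤ C * v a := by
  refine ⟨1 + ∑ a, |x a| / v a, by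
    have : 0 ≤ ∑ a, |x a| / v a := Finset.sum_nonneg fun a _ =>
      div_nonneg (abs_nonneg _) (hv a).le
    linarith, fun a => ?_⟩
  rw [← div_le_iff₀ (hv a)]
  have := Finset.single_le_sum (f := fun a => |x a| / v a)
    (fun a _ => div_nonneg (abs_nonneg _) (hv a).le) (Finset.mem_univ a)
  linarith

variable [DecidableEq S]

theorem pow_apply_nonneg {M : Matrix S S ℝ} (hM : ∀ a b, 0 ≤ M a b) (n : ℕ) :
    ∀ a b, 0 ≤ (M ^ n) a b := by
  induction n with
  | zero => simpa using one_apply_nonneg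
  | succ n ih => rw [pow_succ]; exact mul_apply_nonneg ih hM

theorem pow_mulVec_eq_self {M : Matrix S S ℝ} {x : S → ℝ} (h : M *ᵥ x = x) (n : ℕ) :
    M ^ n *ᵥ x = x := by
  induction n with
  | zero => simp
  | succ n ih => rw [pow_succ, ← Matrix.mulVec_mulVec, h, ih]

theorem pow_mulVec_le {M : Matrix S S ℝ} (hM : ∀ a b, 0 ≤ M a b) {v : S → ℝ} {r : ℝ}
    (hr : 0 ≤ r) (h : ∀ a, (M *ᵥ v) a ≤ r * v a) (n : ℕ) :
    ∀ a, (M ^ n *ᵥ v) a ≤ r ^ n * v a := by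
  induction n with
  | zero => simp
  | succ n ih =>
    intro a
    rw [pow_succ', ← Matrix.mulVec_mulVec]
    refine (mulVec_le_mulVec_of_nonneg (w := r ^ n • v) hM (by simpa using ih) a).trans ?_
    rw [Matrix.mulVec_smul, Pi.smul_apply, smul_eq_mul, pow_succ, mul_assoc]
    exact mul_le_mul_of_nonneg_left (h a) (pow_nonneg hr n)

theorem le_pow_mulVec {M : Matrix S S ℝ} (hM : ∀ a b, 0 ≤ M a b) {v : S → ℝ} {r : ℝ}
    (hr : 0 ≤ r) (h : ∀ a, r * v a ≤ (M *ᵥ v) a) (n : ℕ) :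
    ∀ a, r ^ n * v a ≤ (M ^ n *ᵥ v) a := by
  induction n with
  | zero => simp
  | succ n ih =>
    intro a
    rw [pow_succ' M, ← Matrix.mulVec_mulVec]
    refine le_trans ?_ (mulVec_le_mulVec_of_nonneg (v := r ^ n • v) hM (by simpa using ih) a)
    rw [Matrix.mulVec_smul, Pi.smul_apply, smul_eq_mul, pow_succ, mul_assoc]
    exact mul_le_mul_of_nonneg_left (h a) (pow_nonneg hr n)

theorem isUnit_of_mulVec_eq_zero {M : Matrix S S ℝ} (h : ∀ x, M *ᵥ x = 0 → x = 0) :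
    IsUnit M := by
  rw [← Matrix.mulVec_injective_iff_isUnit]
  intro x y hxy
  have := h (x - y) (by rw [Matrix.mulVec_sub, sub_eq_zero]; exact hxy)
  exact sub_eq_zero.1 this

/-- A nonnegative matrix with unit row sums has a left fixed probability vector. -/
theorem exists_stationary_vector [Nonempty S] {M : Matrix S S ℝ} (hM : ∀ a b, 0 ≤ M a b)
    (h1 : M *ᵥ 1 = 1) : ∃ u : S → ℝ, (∀ a, 0 ≤ u a) ∧ ∑ a, u a = 1 ∧ u ᵥ* M = u := by
  have hdet : (1 - M).det = 0 := by
    rw [← Matrix.exists_mulVec_eq_zero_iff]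
    exact ⟨1, one_ne_zero, by rw [Matrix.sub_mulVec, h1, Matrix.one_mulVec, sub_self]⟩
  obtain ⟨x, hx0, hx⟩ := Matrix.exists_vecMul_eq_zero_iff.2 hdet
  rw [Matrix.vecMul_sub, Matrix.vecMul_one, sub_eq_zero] at hx
  -- Both sides have the same total because the row sums are one, so this inequality is an equality
  -- and `|x|` is itself a left fixed vector.
  have hle : ∀ b, |x b| ≤ ((fun a => |x a|) ᵥ* M) b := fun b => by
    conv_lhs => rw [hx]
    refine (Finset.abs_sum_le_sum_abs _ _).trans (le_of_eq ?_)
    exact Finset.sum_congr rfl fun a _ => by rw [abs_mul, abs_of_nonneg (hM a b)]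
  have hsum : ∑ b, ((fun a => |x a|) ᵥ* M) b = ∑ b, |x b| := by
    have := Matrix.dotProduct_mulVec (fun a => |x a|) M 1
    rw [h1] at this
    simpa [dotProduct] using this.symm
  have heq : (fun a => |x a|) ᵥ* M = fun a => |x a| := by
    funext b
    exact (((Finset.sum_eq_sum_iff_of_le fun b _ => hle b).1 hsum.symm) b
      (Finset.mem_univ b)).symm
  have hpos : 0 < ∑ a, |x a| := by
    obtain ⟨a, ha⟩ := Function.ne_iff.1 hx0
    exact Finset.sum_pos' (fun a _ => abs_nonneg _) ⟨a, Finset.mem_univ a, abs_pos.2 ha⟩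
  refine ⟨(∑ a, |x a|)⁻¹ • fun a => |x a|, fun a => ?_, ?_, ?_⟩
  · exact mul_nonneg (inv_nonneg.2 hpos.le) (abs_nonneg _)
  · simp only [Pi.smul_apply, smul_eq_mul, ← Finset.mul_sum]
    exact inv_mul_cancel₀ hpos.ne'
  · rw [Matrix.smul_vecMul, heq]

/-- Fredholm alternative for a matrix whose only right fixed vectors are constant. -/
theorem exists_sub_mulVec_eq {M : Matrix S S ℝ}
    (hker : ∀ x, M *ᵥ x = x → ∃ c : ℝ, x = fun _ => c) {u : S → ℝ} (hu1 : ∑ a, u a = 1)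
    (hu : u ᵥ* M = u) {d : S → ℝ} (hd : u ⬝ᵥ d = 0) : ∃ h, h - M *ᵥ h = d := by
  -- The rank-one term removes the constants from the kernel of `1 - M`; as `u ⬝ᵥ (T *ᵥ x) = u ⬝ᵥ
  -- x`, it contributes nothing when `u ⬝ᵥ d = 0`.
  let T : Matrix S S ℝ := 1 - M + Matrix.of fun _ b => u b
  have hT : ∀ x, T *ᵥ x = x - M *ᵥ x + fun _ => u ⬝ᵥ x := fun x => by
    simp only [T, Matrix.add_mulVec, Matrix.sub_mulVec, Matrix.one_mulVec]
    rfl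
  have huT : ∀ x, u ⬝ᵥ (T *ᵥ x) = u ⬝ᵥ x := fun x => by
    rw [hT, dotProduct_add, dotProduct_sub, Matrix.dotProduct_mulVec, hu, sub_self, zero_add]
    simp [dotProduct, ← Finset.sum_mul, hu1]
  have hunit : IsUnit T := isUnit_of_mulVec_eq_zero fun x hx => by
    have h0 : u ⬝ᵥ x = 0 := by rw [← huT, hx, dotProduct_zero]
    have hfix := hT x
    rw [hx, h0] at hfix
    have : M *ᵥ x = x := by
      have h2 := hfix.symm
      rw [show (fun _ : S => (0 : ℝ)) = 0 from rfl, add_zero, sub_eq_zero] at h2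
      exact h2.symm
    obtain ⟨c, rfl⟩ := hker x this
    have : c = 0 := by simpa [dotProduct, ← Finset.sum_mul, hu1] using h0
    subst this; rfl
  have hinv : T * T⁻¹ = 1 :=
    Matrix.mul_nonsing_inv T ((Matrix.isUnit_iff_isUnit_det T).1 hunit)
  refine ⟨T⁻¹ *ᵥ d, ?_⟩
  have h1 : T *ᵥ (T⁻¹ *ᵥ d) = d := by rw [Matrix.mulVec_mulVec, hinv, Matrix.one_mulVec]
  have h2 : u ⬝ᵥ (T⁻¹ *ᵥ d) = 0 := by rw [← huT, h1, hd]
  have h3 := hT (T⁻¹ *ᵥ d)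
  rw [h1, h2, show (fun _ : S => (0 : ℝ)) = 0 from rfl, add_zero] at h3
  exact h3.symm

theorem stationaryDistribution_spec {X : Type*} {p : Matrix X X ℝ}
    (h : ∃ π, IsStationaryDistribution p π) :
    IsStationaryDistribution p (stationaryDistribution p) := by
  unfold stationaryDistribution
  rw [dif_pos h]
  exact h.choose_spec

theorem stationaryDistribution_spec_of_fintype [Nonempty S] {M : Matrix S S ℝ}
    (hM : ∀ a b, 0 ≤ M a b) (h1 : M *ᵥ 1 = 1) :
    ∑ a, stationaryDistribution M a = 1 ∧
      stationaryDistribution M ᵥ* M = stationaryDistribution M := by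
  obtain ⟨u, hu0, hu1, hu⟩ := exists_stationary_vector hM h1
  obtain ⟨-, h2, h3⟩ := stationaryDistribution_spec (p := M) ⟨u, hu0, by
    rw [← hu1]; exact hasSum_fintype u, fun y => by
      have := hasSum_fintype fun x => u x * M x y
      rwa [show ∑ x, u x * M x y = u y from congrFun hu y] at this⟩
  exact ⟨(hasSum_fintype _).unique h2, funext fun y => (hasSum_fintype _).unique (h3 y)⟩

end NonnegMatrix

/-! ### Collatz–Wielandt bounds for the spectral radius -/

section SpectralRadius

open Filter Topology

variable {S : Type*} [Fintype S] [DecidableEq S]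

attribute [local instance] Matrix.linftyOpNormedRing Matrix.linftyOpNormedAlgebra

/-- Collatz-Wielandt upper bound. -/
theorem spr_le_of_mulVec_le [Nonempty S] {M : Matrix S S ℝ} (hM : ∀ a b, 0 ≤ M a b)
    {v : S → ℝ} (hv : ∀ a, 0 < v a) {r : ℝ} (h : ∀ a, (M *ᵥ v) a ≤ r * v a) : spr M ≤ r := by
  have hr : 0 ≤ r := by
    obtain ⟨a⟩ := ‹Nonempty S›
    have := (mulVec_apply_nonneg hM (fun b => (hv b).le) a).trans (h a)
    exact nonneg_of_mul_nonneg_left this (hv a)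
  refine ENNReal.toReal_le_of_le_ofReal hr (iSup₂_le fun μ hμ => ?_)
  rw [← Matrix.spectrum_toLin', ← Module.End.hasEigenvalue_iff_mem_spectrum] at hμ
  obtain ⟨x, hx⟩ := hμ.exists_hasEigenvector
  have hx1 := hx.apply_eq_smul
  rw [Matrix.toLin'_apply] at hx1
  -- Evaluating the eigenvalue equation where `‖x a‖ / v a` is largest bounds `‖μ‖` by `r`.
  obtain ⟨a, -, ha⟩ := Finset.exists_max_image Finset.univ (fun a => ‖x a‖ / v a)
    Finset.univ_nonempty
  have hpos : 0 < ‖x a‖ := by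
    obtain ⟨b, hb⟩ := Function.ne_iff.1 hx.2
    have h1 : 0 < ‖x b‖ / v b := div_pos (norm_pos_iff.2 hb) (hv b)
    have h2 := h1.trans_le (ha b (Finset.mem_univ b))
    by_contra h3
    rw [le_antisymm (not_lt.1 h3) (norm_nonneg _)] at h2
    simp at h2
  have key : ‖μ‖ * ‖x a‖ ≤ r * ‖x a‖ := by
    calc ‖μ‖ * ‖x a‖ = ‖∑ b, ((M a b : ℝ) : ℂ) * x b‖ := by
          rw [← norm_mul, ← smul_eq_mul, ← Pi.smul_apply, ← hx1]; rfl
      _ ≤ ∑ b, M a b * ‖x b‖ := by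
          refine (norm_sum_le _ _).trans (le_of_eq (Finset.sum_congr rfl fun b _ => ?_))
          rw [norm_mul, Complex.norm_real, Real.norm_of_nonneg (hM a b)]
      _ ≤ ∑ b, M a b * (‖x a‖ / v a * v b) := Finset.sum_le_sum fun b _ =>
          mul_le_mul_of_nonneg_left ((div_le_iff₀ (hv b)).1 (ha b (Finset.mem_univ b))) (hM a b)
      _ = ‖x a‖ / v a * (M *ᵥ v) a := by
          rw [Matrix.mulVec, dotProduct, Finset.mul_sum]
          exact Finset.sum_congr rfl fun b _ => by ring
      _ ≤ ‖x a‖ / v a * (r * v a) :=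
          mul_le_mul_of_nonneg_left (h a) (div_nonneg (norm_nonneg _) (hv a).le)
      _ = r * ‖x a‖ := by have := (hv a).ne'; field_simp
  rw [← ENNReal.ofReal_coe_nnreal]
  exact ENNReal.ofReal_le_ofReal (le_of_mul_le_mul_right key hpos)

/-- Collatz-Wielandt lower bound. -/
theorem le_spr_of_le_mulVec [Nonempty S] {M : Matrix S S ℝ} (hM : ∀ a b, 0 ≤ M a b)
    {v : S → ℝ} (hv : ∀ a, 0 < v a) {r : ℝ} (h : ∀ a, r * v a ≤ (M *ᵥ v) a) : r ≤ spr M := by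
  rcases lt_or_ge r 0 with hr | hr
  · exact hr.le.trans ENNReal.toReal_nonneg
  set Mc : Matrix S S ℂ := M.map (fun x : ℝ => (x : ℂ)) with hMc
  let vc : S → ℂ := fun a => (v a : ℂ)
  have hpow : ∀ n, Mc ^ n = (M ^ n).map (fun x : ℝ => (x : ℂ)) := fun n =>
    (map_pow (Complex.ofRealHom.mapMatrix (m := S)) M n).symm
  have hvc : 0 < ‖vc‖ := by
    obtain ⟨a⟩ := ‹Nonempty S›
    exact norm_pos_iff.2 fun h0 => (hv a).ne' (by simpa [vc] using congrFun h0 a)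
  have hnorm : ∀ n, r ^ n ≤ ‖Mc ^ n‖ := fun n => by
    have h1 : r ^ n * ‖vc‖ ≤ ‖Mc ^ n *ᵥ vc‖ := by
      rw [← Real.norm_of_nonneg (pow_nonneg hr n), ← norm_smul,
        pi_norm_le_iff_of_nonneg (norm_nonneg _)]
      intro a
      refine le_trans ?_ (norm_le_pi_norm _ a)
      have h2 : (Mc ^ n *ᵥ vc) a = (((M ^ n *ᵥ v) a : ℝ) : ℂ) := by
        rw [hpow]; simp [Matrix.mulVec, dotProduct, vc]
      have h3 := le_pow_mulVec hM hr h n a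
      have h4 : 0 ≤ r ^ n * v a := mul_nonneg (pow_nonneg hr n) (hv a).le
      rw [h2, Complex.norm_real, Real.norm_of_nonneg (h4.trans h3), Pi.smul_apply, norm_smul,
        Complex.norm_real, Real.norm_of_nonneg (hv a).le, Real.norm_of_nonneg (pow_nonneg hr n)]
      exact h3
    exact le_of_mul_le_mul_right (h1.trans (Matrix.linfty_opNorm_mulVec _ _)) hvc
  -- Gelfand's formula converts the growth `r ^ n ≤ ‖Mc ^ n‖` into a bound on the spectral radius.
  have hlim := spectrum.pow_norm_pow_one_div_tendsto_nhds_spectralRadius Mc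
  have hle : ENNReal.ofReal r ≤ spectralRadius ℂ Mc := by
    refine ge_of_tendsto hlim (eventually_atTop.2 ⟨1, fun n hn => ENNReal.ofReal_le_ofReal ?_⟩)
    have hn0 : (n : ℝ) ≠ 0 := by positivity
    calc r = (r ^ n) ^ (1 / (n : ℝ)) := by
          rw [← Real.rpow_natCast, ← Real.rpow_mul hr, mul_one_div_cancel hn0, Real.rpow_one]
      _ ≤ _ := Real.rpow_le_rpow (pow_nonneg hr n) (hnorm n) (by positivity)
  have htop : spectralRadius ℂ Mc ≠ ⊤ :=
    ne_top_of_le_ne_top ENNReal.coe_ne_top (spectrum.spectralRadius_le_nnnorm Mc)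
  exact (ENNReal.ofReal_le_iff_le_toReal htop).1 hle

end SpectralRadius

/-! ### Differentiating the Perron root at a stochastic matrix -/

section Derivative

open Filter Topology

variable {S : Type*} [Fintype S]

theorem HasDerivAt.matrix_mulVec_pi {M : ℝ → Matrix S S ℝ} {M' : Matrix S S ℝ}
    {f : ℝ → S → ℝ} {f' : S → ℝ} {x : ℝ} (hM : ∀ a b, HasDerivAt (fun z => M z a b) (M' a b) x)
    (hf : HasDerivAt f f' x) :
    HasDerivAt (fun z => M z *ᵥ f z) (M' *ᵥ f x + M x *ᵥ f') x := by
  rw [hasDerivAt_pi] at hf ⊢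
  intro a
  have := HasDerivAt.fun_sum (u := Finset.univ) fun b _ => (hM a b).mul (hf b)
  rwa [Finset.sum_add_distrib] at this

/-- Since `f x = 0`, the difference quotient of the product is `L z` applied to that of `f`, so
continuity of `L` suffices. -/
theorem hasDerivAt_mulVec_of_eq_zero {L : ℝ → Matrix S S ℝ} {f : ℝ → S → ℝ} {f' : S → ℝ} {x : ℝ}
    (hL : ContinuousAt L x) (hf : HasDerivAt f f' x) (h0 : f x = 0) :
    HasDerivAt (fun z => L z *ᵥ f z) (L x *ᵥ f') x := by
  rw [hasDerivAt_iff_tendsto_slope] at hf ⊢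
  have hc : Continuous fun p : Matrix S S ℝ × (S → ℝ) => p.1 *ᵥ p.2 := by fun_prop
  have h1 : Tendsto L (𝓝[≠] x) (𝓝 (L x)) := hL.tendsto.mono_left nhdsWithin_le_nhds
  refine ((hc.tendsto (L x, f')).comp (h1.prodMk_nhds hf)).congr fun z => ?_
  simp [slope_def_module, h0, Matrix.mulVec_smul]

variable [DecidableEq S]

/-- The derivative of the Perron eigenvalue at a stochastic matrix with one recurrent class. -/
theorem hasDerivAt_spr [Nonempty S] {M : ℝ → Matrix S S ℝ} {x : ℝ}
    (hM : ∀ᶠ z in 𝓝 x, ∀ a b, 0 ≤ M z a b) (hcont : ContinuousAt M x) (h1 : M x *ᵥ 1 = 1)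
    (hker : ∀ y, M x *ᵥ y = y → ∃ c : ℝ, y = fun _ => c) {u : S → ℝ} (hu1 : ∑ a, u a = 1)
    (hu : u ᵥ* M x = u) {d : S → ℝ} (hd : HasDerivAt (fun z => M z *ᵥ 1) d x) :
    HasDerivAt (fun z => spr (M z)) (u ⬝ᵥ d) x := by
  set κ := u ⬝ᵥ d with hκ
  have hu1' : u ⬝ᵥ (1 : S → ℝ) = 1 := by simpa [dotProduct] using hu1
  -- This Poisson equation makes `1 + (z - x) • h` an eigenvector of `M z` for `1 + (z - x) * κ` up
  -- to `o(z - x)`.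
  obtain ⟨h, hh⟩ := exists_sub_mulVec_eq hker hu1 hu (d := d - κ • 1) (by
    rw [dotProduct_sub, dotProduct_smul, hu1', smul_eq_mul, mul_one, sub_self])
  have hlin : HasDerivAt (fun z => (z - x) • h) h x := by
    simpa using ((hasDerivAt_id x).sub_const x).smul_const h
  have hv : HasDerivAt (fun z => 1 + (z - x) • h) h x := hlin.const_add 1
  have hscal : HasDerivAt (fun z => 1 + (z - x) * κ) κ x := by
    simpa using (((hasDerivAt_id x).sub_const x).mul_const κ).const_add 1
  have hF : HasDerivAt (fun z => M z *ᵥ (1 + (z - x) • h) -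
      (1 + (z - x) * κ) • (1 + (z - x) • h)) 0 x := by
    have e1 := hd.add (hasDerivAt_mulVec_of_eq_zero hcont hlin (by simp))
    have e2 := e1.sub (hscal.smul hv)
    refine (e2.congr_deriv ?_).congr_of_eventuallyEq (Eventually.of_forall fun z => ?_)
    · rw [show M x *ᵥ h = h - (d - κ • 1) by rw [← hh]; abel]
      simp only [sub_self, zero_mul, zero_smul, add_zero, one_smul]
      abel
    · simp [Matrix.mulVec_add]
  have hFx : M x *ᵥ (1 + (x - x) • h) - (1 + (x - x) * κ) • (1 + (x - x) • h) = 0 := by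
    simp [h1]
  -- The test vector stays above `1 / 2`, so a sup-norm error `ε / 2 * ‖z - x‖` is at most `ε * ‖z -
  -- x‖` times it, and both Collatz–Wielandt bounds apply.
  have hbound : ∀ᶠ z in 𝓝 x, ∀ a, (1 / 2 : ℝ) ≤ (1 + (z - x) • h) a := by
    rw [eventually_all]
    intro a
    have : Tendsto (fun z => (1 + (z - x) • h) a) (𝓝 x) (𝓝 1) := by
      have := (hasDerivAt_pi.1 hv a).continuousAt.tendsto
      simpa using this
    exact this.eventually_const_le (by norm_num)
  have hsx : spr (M x) = 1 := by
    have hnn := hM.self_of_nhds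
    exact le_antisymm (spr_le_of_mulVec_le (v := 1) hnn (by simp) (by simp [h1]))
      (le_spr_of_le_mulVec (v := 1) hnn (by simp) (by simp [h1]))
  rw [hasDerivAt_iff_isLittleO, Asymptotics.isLittleO_iff] at hF ⊢
  intro ε hε
  filter_upwards [hF (half_pos hε), hM, hbound] with z hz hnn hb
  rw [hFx, sub_zero, smul_zero, sub_zero] at hz
  have hpos : ∀ a, 0 < (1 + (z - x) • h) a := fun a => lt_of_lt_of_le (by norm_num) (hb a)
  have hcomp : ∀ a, |(M z *ᵥ (1 + (z - x) • h)) a - (1 + (z - x) * κ) * (1 + (z - x) • h) a|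
      ≤ ε * ‖z - x‖ * (1 + (z - x) • h) a := fun a => by
    refine ((norm_le_pi_norm _ a).trans hz).trans ?_
    have : 0 ≤ ε * ‖z - x‖ := mul_nonneg hε.le (norm_nonneg _)
    nlinarith [hb a]
  have hup : spr (M z) ≤ 1 + (z - x) * κ + ε * ‖z - x‖ :=
    spr_le_of_mulVec_le hnn hpos fun a => by
      have := (abs_le.1 (hcomp a)).2
      rw [add_mul]; linarith
  have hlo : 1 + (z - x) * κ - ε * ‖z - x‖ ≤ spr (M z) :=
    le_spr_of_le_mulVec hnn hpos fun a => by
      have := (abs_le.1 (hcomp a)).1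
      rw [sub_mul]; linarith
  rw [hsx, Real.norm_eq_abs, abs_le, smul_eq_mul]
  constructor <;> linarith

end Derivative

/-! ### Minimal nonnegative solutions by monotone iteration -/

section MinimalSolution

open Filter Topology

variable {S : Type*}

/-- The iterates of `F` from `0` increase and stay below every nonnegative solution. The closed
invariant `P` bounds them by `B`, hence they converge, and `P` passes to the limit. -/
theorem exists_isMinNonnegSolution {F : Matrix S S ℝ → Matrix S S ℝ}
    (hmono : ∀ X Y : Matrix S S ℝ, (∀ a b, 0 ≤ X a b) → (∀ a b, X a b ≤ Y a b) →
      ∀ a b, F X a b ≤ F Y a b)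
    (hcont : Continuous F) (h0 : ∀ a b, 0 ≤ F 0 a b) {P : Matrix S S ℝ → Prop} (hP0 : P 0)
    (hPF : ∀ X : Matrix S S ℝ, (∀ a b, 0 ≤ X a b) → P X → P (F X)) (hcl : IsClosed {X | P X})
    {B : Matrix S S ℝ}
    (hB : ∀ X : Matrix S S ℝ, (∀ a b, 0 ≤ X a b) → P X → ∀ a b, X a b ≤ B a b) :
    ∃ M, IsMinNonnegSolution (fun X => F X = X) M ∧ P M := by
  let X : ℕ → Matrix S S ℝ := fun n => F^[n] 0
  have hX : ∀ n, X (n + 1) = F (X n) := fun n => Function.iterate_succ_apply' F n 0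
  have hnn : ∀ n a b, 0 ≤ X n a b := by
    intro n
    induction n with
    | zero => intro a b; exact le_rfl
    | succ n ih =>
      intro a b
      rw [hX]
      exact (h0 a b).trans (hmono 0 (X n) (fun _ _ => le_rfl) ih a b)
  have hP : ∀ n, P (X n) := by
    intro n
    induction n with
    | zero => exact hP0
    | succ n ih => rw [hX]; exact hPF _ (hnn n) ih
  have hstep : ∀ n a b, X n a b ≤ X (n + 1) a b := by
    intro n
    induction n with
    | zero => intro a b; exact hnn 1 a b
    | succ n ih =>
      intro a b
      rw [hX, hX (n + 1)]
      exact hmono _ _ (hnn n) ih a b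
  have hlim : ∀ a b, Tendsto (fun n => X n a b) atTop (𝓝 (⨆ n, X n a b)) := fun a b =>
    tendsto_atTop_ciSup (monotone_nat_of_le_succ fun n => hstep n a b)
      ⟨B a b, by rintro _ ⟨n, rfl⟩; exact hB _ (hnn n) (hP n) a b⟩
  let M : Matrix S S ℝ := fun a b => ⨆ n, X n a b
  have hM : Tendsto X atTop (𝓝 M) :=
    tendsto_pi_nhds.2 fun a => tendsto_pi_nhds.2 fun b => hlim a b
  refine ⟨M, ⟨fun a b => ge_of_tendsto' (hlim a b) fun n => hnn n a b, ?_, ?_⟩,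
    hcl.mem_of_tendsto hM (Eventually.of_forall hP)⟩
  · refine tendsto_nhds_unique ?_ ((tendsto_add_atTop_iff_nat 1).2 hM)
    exact ((hcont.tendsto M).comp hM).congr fun n => (hX n).symm
  · intro N hN hFN a b
    refine le_of_tendsto' (hlim a b) fun n => ?_
    have : ∀ a b, X n a b ≤ N a b := by
      induction n with
      | zero => exact hN
      | succ n ih =>
        intro a b
        rw [hX, ← hFN]
        exact hmono _ _ (hnn n) ih a b
    exact this a b

theorem minNonnegSolution_eq {E : Matrix S S ℝ → Prop} {M : Matrix S S ℝ}
    (h : IsMinNonnegSolution E M) : minNonnegSolution E = M := by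
  have hex : ∃ M, IsMinNonnegSolution E M := ⟨M, h⟩
  have hs : IsMinNonnegSolution E (minNonnegSolution E) := by
    unfold minNonnegSolution
    rw [dif_pos hex]
    exact hex.choose_spec
  ext a b
  exact le_antisymm (hs.2.2 M h.1 h.2.1 a b) (h.2.2 _ hs.1 hs.2.1 a b)

end MinimalSolution

/-! ### Nonnegative matrices contracting a positive vector -/

section Contraction

variable {S : Type*} [Fintype S]

theorem exists_lt_one_mulVec_le [Nonempty S] {M : Matrix S S ℝ} (hM : ∀ a b, 0 ≤ M a b)
    {v : S → ℝ} (hv : ∀ a, 0 < v a) (h : ∀ a, (M *ᵥ v) a < v a) :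
    ∃ r, 0 ≤ r ∧ r < 1 ∧ ∀ a, (M *ᵥ v) a ≤ r * v a := by
  obtain ⟨a, -, ha⟩ := Finset.exists_max_image Finset.univ (fun a => (M *ᵥ v) a / v a)
    Finset.univ_nonempty
  exact ⟨(M *ᵥ v) a / v a, div_nonneg (mulVec_apply_nonneg hM (fun b => (hv b).le) a) (hv a).le,
    (div_lt_one (hv a)).2 (h a), fun b => (div_le_iff₀ (hv b)).1 (ha b (Finset.mem_univ b))⟩

/-- Starting from `y ≥ -C v`, iterating `M y ≤ y` improves the bound to `y ≥ -C r ^ n v`, with `r <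
1` the contraction rate on `v`. -/
theorem nonneg_of_mulVec_le [Nonempty S] {M : Matrix S S ℝ} (hM : ∀ a b, 0 ≤ M a b)
    {v : S → ℝ} (hv : ∀ a, 0 < v a) (h : ∀ a, (M *ᵥ v) a < v a) {y : S → ℝ}
    (hy : ∀ a, (M *ᵥ y) a ≤ y a) (a : S) : 0 ≤ y a := by
  obtain ⟨r, hr0, hr1, hr⟩ := exists_lt_one_mulVec_le hM hv h
  obtain ⟨C, hC0, hC⟩ := exists_le_mul_of_pos y hv
  have key : ∀ n : ℕ, ∀ a, -(C * r ^ n) * v a ≤ y a := by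
    intro n
    induction n with
    | zero => intro a; have := neg_le_of_abs_le (hC a); simpa using this
    | succ n ih =>
      intro a
      refine le_trans ?_ (hy a)
      have h1 := mulVec_le_mulVec_of_nonneg (v := (-(C * r ^ n)) • v) hM (by simpa using ih) a
      rw [Matrix.mulVec_smul, Pi.smul_apply, smul_eq_mul] at h1
      refine le_trans ?_ h1
      have := mul_le_mul_of_nonneg_left (hr a) (mul_nonneg hC0.le (pow_nonneg hr0 n))
      rw [pow_succ]; linarith
  have hlim : Filter.Tendsto (fun n : ℕ => -(C * r ^ n) * v a) Filter.atTop (nhds 0) := by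
    have := (((tendsto_pow_atTop_nhds_zero_of_lt_one hr0 hr1).const_mul C).neg).mul_const (v a)
    simpa using this
  exact le_of_tendsto' hlim fun n => key n a

variable [DecidableEq S]

theorem isUnit_one_sub [Nonempty S] {M : Matrix S S ℝ} (hM : ∀ a b, 0 ≤ M a b)
    {v : S → ℝ} (hv : ∀ a, 0 < v a) (h : ∀ a, (M *ᵥ v) a < v a) : IsUnit (1 - M).det := by
  rw [← Matrix.isUnit_iff_isUnit_det]
  refine isUnit_of_mulVec_eq_zero fun x hx => ?_
  rw [Matrix.sub_mulVec, Matrix.one_mulVec, sub_eq_zero] at hx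
  funext a
  refine le_antisymm ?_ (nonneg_of_mulVec_le hM hv h (fun a => by rw [← hx]) a)
  have := nonneg_of_mulVec_le (y := -x) hM hv h (fun a => by rw [Matrix.mulVec_neg, ← hx]) a
  simpa using this

theorem one_sub_inv_apply_nonneg [Nonempty S] {M : Matrix S S ℝ} (hM : ∀ a b, 0 ≤ M a b)
    {v : S → ℝ} (hv : ∀ a, 0 < v a) (h : ∀ a, (M *ᵥ v) a < v a) (a b : S) :
    0 ≤ (1 - M)⁻¹ a b := by
  have h1 : (1 - M) * (1 - M)⁻¹ = 1 := Matrix.mul_nonsing_inv _ (isUnit_one_sub hM hv h)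
  refine nonneg_of_mulVec_le (y := fun a => (1 - M)⁻¹ a b) hM hv h (fun c => ?_) a
  have h2 := congrFun (congrFun h1 c) b
  rw [Matrix.sub_mul, Matrix.one_mul, Matrix.sub_apply] at h2
  have h3 := one_apply_nonneg c b
  rw [← h2, Matrix.mul_apply] at h3
  exact sub_nonneg.1 h3

end Contraction

/-! ### The G-matrix and the rate matrix of a stable triplet -/

section QuasiBirthDeath

variable {S : Type*} [Fintype S]

/-- The bound `X v ≤ w v` survives the iteration defining the minimal solution: it implies `X² v ≤
w² v`, and the Lyapunov inequality closes the estimate. -/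
theorem gMatrix_spec [DecidableEq S] {D : ℤ → Matrix S S ℝ} (hdown : ∀ a b, 0 ≤ D (-1) a b)
    (hstay : ∀ a b, 0 ≤ D 0 a b) (hup : ∀ a b, 0 ≤ D 1 a b) {w : ℝ} (hw : 0 ≤ w) {v : S → ℝ}
    (hv : ∀ a, 0 < v a)
    (h : ∀ a, (D (-1) *ᵥ v) a + w * (D 0 *ᵥ v) a + w ^ 2 * (D 1 *ᵥ v) a ≤ w * v a) :
    IsMinNonnegSolution (fun M => D (-1) + D 0 * M + D 1 * M ^ 2 = M) (gMatrix D) ∧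
      ∀ a, (gMatrix D *ᵥ v) a ≤ w * v a := by
  suffices hex : ∃ M, IsMinNonnegSolution (fun M => D (-1) + D 0 * M + D 1 * M ^ 2 = M) M ∧
      ∀ a, (M *ᵥ v) a ≤ w * v a by
    obtain ⟨M, hM, hP⟩ := hex
    have : gMatrix D = M := minNonnegSolution_eq hM
    rw [this]; exact ⟨hM, hP⟩
  refine exists_isMinNonnegSolution
    (F := fun M => D (-1) + D 0 * M + D 1 * M ^ 2) (P := fun X => ∀ a, (X *ᵥ v) a ≤ w * v a)
    (B := fun a b => w * v a / v b) ?_ (by fun_prop) ?_ ?_ ?_ ?_ ?_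
  · intro X Y hX hXY a b
    have hY : ∀ a b, 0 ≤ Y a b := fun a b => (hX a b).trans (hXY a b)
    have h1 := mul_apply_le_mul_apply (fun a b => le_refl (D 0 a b)) hXY hX hstay a b
    have h2 := mul_apply_le_mul_apply hXY hXY hX hY
    have h3 := mul_apply_le_mul_apply (fun a b => le_refl (D 1 a b)) h2
      (mul_apply_nonneg hX hX) hup a b
    simp only [sq, Matrix.add_apply]
    linarith
  · intro a b; simpa using hdown a b
  · intro a; simpa using mul_nonneg hw (hv a).le
  · intro X hX hXv a
    have e1 : ∀ a, (X *ᵥ v) a ≤ (w • v) a := by simpa using hXv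
    have h1 := mulVec_le_mulVec_of_nonneg hstay e1 a
    have h2 : ∀ a, (X *ᵥ (X *ᵥ v)) a ≤ (w ^ 2 • v) a := fun a => by
      refine (mulVec_le_mulVec_of_nonneg hX e1 a).trans ?_
      rw [Matrix.mulVec_smul, Pi.smul_apply, Pi.smul_apply, smul_eq_mul, smul_eq_mul, sq,
        mul_assoc]
      exact mul_le_mul_of_nonneg_left (hXv a) hw
    have h3 := mulVec_le_mulVec_of_nonneg hup h2 a
    rw [Matrix.mulVec_smul, Pi.smul_apply, smul_eq_mul] at h1 h3
    simp only [Matrix.add_mulVec, sq X, ← Matrix.mulVec_mulVec, Pi.add_apply]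
    linarith [h a]
  · simp only [Set.ofPred_forall]
    refine isClosed_iInter fun a => isClosed_le ?_ continuous_const
    fun_prop
  · exact fun X hX hXv => apply_le_of_mulVec_le hX hv hXv

/-- A stochastic block triplet whose level drifts downwards, as certified by a geometric
Lyapunov function. -/
structure StableTriplet (D : ℤ → Matrix S S ℝ) (w ρ : ℝ) (v : S → ℝ) : Prop where
  down_nonneg : ∀ a b, 0 ≤ D (-1) a b
  stay_nonneg : ∀ a b, 0 ≤ D 0 a b
  up_nonneg : ∀ a b, 0 ≤ D 1 a b
  stochastic : D (-1) *ᵥ 1 + D 0 *ᵥ 1 + D 1 *ᵥ 1 = 1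
  one_lt : 1 < w
  rate_nonneg : 0 ≤ ρ
  rate_lt_one : ρ < 1
  pos : ∀ a, 0 < v a
  lyapunov : ∀ a, (D (-1) *ᵥ v) a + w * (D 0 *ᵥ v) a + w ^ 2 * (D 1 *ᵥ v) a ≤ ρ * (w * v a)

namespace StableTriplet

variable {D : ℤ → Matrix S S ℝ} {w ρ : ℝ} {v : S → ℝ} (h : StableTriplet D w ρ v)

include h

theorem w_pos : 0 < w := one_pos.trans h.one_lt

theorem exists_pos_bound [Nonempty S] (x : S → ℝ) : ∃ C, 0 < C ∧ ∀ a, |x a| ≤ C * v a :=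
  exists_le_mul_of_pos x h.pos

/-- Comparison principle for subharmonic functions of moderate growth vanishing at level `0`. -/
theorem nonpos_of_subharmonic {y : ℕ → S → ℝ} (h0 : ∀ a, y 0 a ≤ 0) {C : ℝ} (hC : 0 ≤ C)
    (hb : ∀ k a, y k a ≤ C * w ^ k * v a)
    (hsub : ∀ k a, y (k + 1) a ≤
      (D (-1) *ᵥ y k + D 0 *ᵥ y (k + 1) + D 1 *ᵥ y (k + 2)) a) (k : ℕ) (a : S) : y k a ≤ 0 := by
  have hw := h.w_pos
  -- Each insertion of the growth bound into the subharmonic inequality gains a factor `ρ`.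
  have key : ∀ n : ℕ, ∀ k a, y k a ≤ (C * ρ ^ n * w ^ k) * v a := by
    intro n
    induction n with
    | zero => simpa using hb
    | succ n ih =>
      intro k a
      cases k with
      | zero =>
        exact (h0 a).trans (mul_nonneg (mul_nonneg (mul_nonneg hC (pow_nonneg h.rate_nonneg _))
          (pow_nonneg hw.le _)) (h.pos a).le)
      | succ k =>
        have e : ∀ k a, y k a ≤ ((C * ρ ^ n * w ^ k) • v) a := ih
        have h1 := mulVec_le_mulVec_of_nonneg h.down_nonneg (e k) a
        have h2 := mulVec_le_mulVec_of_nonneg h.stay_nonneg (e (k + 1)) a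
        have h3 := mulVec_le_mulVec_of_nonneg h.up_nonneg (e (k + 2)) a
        rw [Matrix.mulVec_smul, Pi.smul_apply, smul_eq_mul] at h1 h2 h3
        have h4 := hsub k a
        have h5 := mul_le_mul_of_nonneg_left (h.lyapunov a)
          (mul_nonneg (mul_nonneg hC (pow_nonneg h.rate_nonneg n)) (pow_nonneg hw.le k))
        simp only [Pi.add_apply] at h4
        refine h4.trans ((add_le_add (add_le_add h1 h2) h3).trans (le_trans (le_of_eq ?_)
          (h5.trans (le_of_eq ?_))))
        · rw [pow_succ w (k + 1), pow_succ w k]; ring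
        · ring
  have hlim : Filter.Tendsto (fun n : ℕ => C * ρ ^ n * w ^ k * v a) Filter.atTop (nhds 0) := by
    have := (((tendsto_pow_atTop_nhds_zero_of_lt_one h.rate_nonneg h.rate_lt_one).const_mul
      C).mul_const (w ^ k)).mul_const (v a)
    simpa using this
  exact ge_of_tendsto' hlim fun n => key n k a

variable [DecidableEq S]

theorem g_spec : IsMinNonnegSolution (fun M => D (-1) + D 0 * M + D 1 * M ^ 2 = M) (gMatrix D) ∧
    ∀ a, (gMatrix D *ᵥ v) a ≤ w * v a :=
  gMatrix_spec h.down_nonneg h.stay_nonneg h.up_nonneg h.w_pos.le h.pos fun a =>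
    (h.lyapunov a).trans (mul_le_of_le_one_left (mul_pos h.w_pos (h.pos a)).le h.rate_lt_one.le)

theorem g_nonneg : ∀ a b, 0 ≤ gMatrix D a b := h.g_spec.1.1

theorem g_eq : D (-1) + D 0 * gMatrix D + D 1 * (gMatrix D * gMatrix D) = gMatrix D := by
  rw [← sq]; exact h.g_spec.1.2.1

theorem g_mulVec (x : S → ℝ) : gMatrix D *ᵥ x = D (-1) *ᵥ x + D 0 *ᵥ (gMatrix D *ᵥ x) +
    D 1 *ᵥ (gMatrix D *ᵥ (gMatrix D *ᵥ x)) := by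
  conv_lhs => rw [← h.g_eq]
  simp only [Matrix.add_mulVec, Matrix.mulVec_mulVec]

/-- The functions `1 - G ^ k 1` are harmonic in the level, vanish at level `0` and are bounded, so
the comparison principle makes them nonpositive; `G 1 ≤ 1` comes from the trivial Lyapunov pair `w =
1`, `v = 1`. -/
theorem g_mulVec_one [Nonempty S] : gMatrix D *ᵥ 1 = 1 := by
  have hle : ∀ a, (gMatrix D *ᵥ 1) a ≤ 1 * (1 : S → ℝ) a :=
    (gMatrix_spec h.down_nonneg h.stay_nonneg h.up_nonneg zero_le_one (v := 1) (by simp)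
      fun a => by
        have := congrFun h.stochastic a
        simp only [Pi.add_apply] at this
        simp [this]).2
  obtain ⟨C, hC, hC1⟩ := h.exists_pos_bound 1
  have key := h.nonpos_of_subharmonic (y := fun k => 1 - gMatrix D ^ k *ᵥ 1) (by simp) hC.le
    (fun k a => by
      have h1 := mulVec_apply_nonneg (pow_apply_nonneg h.g_nonneg k) (v := 1) (by simp) a
      have h2 := hC1 a
      have h3 : 1 ≤ w ^ k := one_le_pow₀ h.one_lt.le
      have h4 := mul_pos hC (h.pos a)
      simp only [Pi.one_apply, abs_one] at h2
      simp only [Pi.sub_apply, Pi.one_apply]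
      nlinarith)
    (fun k a => le_of_eq (congrFun (by
      have e : ∀ k, gMatrix D ^ (k + 1) *ᵥ (1 : S → ℝ) =
          gMatrix D *ᵥ (gMatrix D ^ k *ᵥ 1) := fun k => by
        rw [pow_succ', Matrix.mulVec_mulVec]
      have e1 : gMatrix D ^ (k + 1) *ᵥ (1 : S → ℝ) = D (-1) *ᵥ (gMatrix D ^ k *ᵥ 1) +
          D 0 *ᵥ (gMatrix D ^ (k + 1) *ᵥ 1) + D 1 *ᵥ (gMatrix D ^ (k + 2) *ᵥ 1) := by
        have := h.g_mulVec (gMatrix D ^ k *ᵥ 1)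
        rwa [← e, ← e] at this
      refine (congrArg₂ (· - ·) h.stochastic.symm e1).trans ?_
      simp only [Matrix.mulVec_sub]
      abel) a)) 1
  funext a
  refine le_antisymm (by simpa using hle a) ?_
  have := key a
  simp only [pow_one, Pi.sub_apply] at this
  linarith

/-- This is inverse positivity of `K`. The partial sums `y k = ∑ i < k, G ^ i x` are superharmonic
with defect exactly `K x`, so comparison applies to `-y`; at level one `y 1 = x`. -/
theorem nonneg_of_k_mulVec_nonneg [Nonempty S] {x : S → ℝ}
    (hx : ∀ a, (D 0 *ᵥ x + D 1 *ᵥ x + D 1 *ᵥ (gMatrix D *ᵥ x)) a ≤ x a) (a : S) : 0 ≤ x a := by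
  let y : ℕ → S → ℝ := fun k => Nat.rec 0 (fun _ y => x + gMatrix D *ᵥ y) k
  have hy0 : y 0 = 0 := rfl
  have hy : ∀ k, y (k + 1) = x + gMatrix D *ᵥ y k := fun _ => rfl
  obtain ⟨C, hC, hCx⟩ := h.exists_pos_bound x
  have hw1 : 0 < w - 1 := sub_pos.2 h.one_lt
  -- From `G v ≤ w v`, summing the geometric series `1 + w + ⋯ + w ^ (k - 1)`.
  have hbound : ∀ k a, -y k a ≤ C / (w - 1) * (w ^ k - 1) * v a := by
    intro k
    induction k with
    | zero => simp [hy0]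
    | succ k ih =>
      intro a
      have h1 := mulVec_le_mulVec_of_nonneg (v := -y k)
        (w := (C / (w - 1) * (w ^ k - 1)) • v) h.g_nonneg (by simpa using ih) a
      rw [Matrix.mulVec_smul, Matrix.mulVec_neg, Pi.smul_apply, smul_eq_mul, Pi.neg_apply] at h1
      have h2 := neg_le_of_abs_le (hCx a)
      have h4 : 0 ≤ C / (w - 1) * (w ^ k - 1) :=
        mul_nonneg (div_pos hC hw1).le (sub_nonneg.2 (one_le_pow₀ h.one_lt.le))
      have h3 := mul_le_mul_of_nonneg_left (h.g_spec.2 a) h4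
      rw [hy, Pi.add_apply]
      have e : C / (w - 1) * (w ^ (k + 1) - 1) * v a =
          C * v a + C / (w - 1) * (w ^ k - 1) * (w * v a) := by
        field_simp
        ring
      linarith
  have key := h.nonpos_of_subharmonic (y := fun k => -y k) (by simp [hy0]) (div_pos hC hw1).le
    (fun k a => (hbound k a).trans (by
      have := mul_pos (div_pos hC hw1) (h.pos a)
      nlinarith))
    (fun k a => by
      have e := congrFun (h.g_mulVec (y k)) a
      have hxa := hx a
      simp only [hy, Matrix.mulVec_neg, Matrix.mulVec_add, Pi.add_apply, Pi.neg_apply] at e hxa ⊢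
      linarith) 1 a
  simpa [hy, hy0] using key

/-- The transition matrix of the phase while the level, censored, stays put is nonnegative. -/
theorem u_nonneg : ∀ a b, 0 ≤ (D 0 + D 1 * gMatrix D) a b := fun a b =>
  add_nonneg (h.stay_nonneg a b) (mul_apply_nonneg h.up_nonneg h.g_nonneg a b)

/-- Using `G v ≤ w v`, `w U v ≤ w D₀ v + w² D₁ v ≤ ρ w v`, and `ρ < 1`. -/
theorem u_mulVec_lt (a : S) : ((D 0 + D 1 * gMatrix D) *ᵥ v) a < v a := by
  have h1 := mulVec_le_mulVec_of_nonneg (w := w • v) h.up_nonneg (by simpa using h.g_spec.2) a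
  have h2 := mulVec_apply_nonneg h.down_nonneg (fun b => (h.pos b).le) a
  have h3 := h.lyapunov a
  have h4 := mul_pos h.w_pos (h.pos a)
  rw [Matrix.mulVec_smul, Pi.smul_apply, smul_eq_mul] at h1
  rw [Matrix.add_mulVec, ← Matrix.mulVec_mulVec, Pi.add_apply]
  have h5 := mul_le_mul_of_nonneg_left h1 h.w_pos.le
  refine lt_of_mul_lt_mul_left (a := w) ?_ h.w_pos.le
  nlinarith [h.rate_lt_one]

theorem n_nonneg [Nonempty S] : ∀ a b, 0 ≤ (1 - (D 0 + D 1 * gMatrix D))⁻¹ a b :=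
  one_sub_inv_apply_nonneg h.u_nonneg h.pos h.u_mulVec_lt

theorem n_mul [Nonempty S] :
    (1 - (D 0 + D 1 * gMatrix D))⁻¹ * (1 - (D 0 + D 1 * gMatrix D)) = 1 :=
  Matrix.nonsing_inv_mul _ (isUnit_one_sub h.u_nonneg h.pos h.u_mulVec_lt)

theorem mul_n [Nonempty S] :
    (1 - (D 0 + D 1 * gMatrix D)) * (1 - (D 0 + D 1 * gMatrix D))⁻¹ = 1 :=
  Matrix.mul_nonsing_inv _ (isUnit_one_sub h.u_nonneg h.pos h.u_mulVec_lt)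

theorem g_eq_n_mul [Nonempty S] :
    gMatrix D = (1 - (D 0 + D 1 * gMatrix D))⁻¹ * D (-1) := by
  have e : (1 - (D 0 + D 1 * gMatrix D)) * gMatrix D = D (-1) := by
    rw [Matrix.sub_mul, Matrix.one_mul, Matrix.add_mul, Matrix.mul_assoc]
    nth_rewrite 1 [← h.g_eq]
    abel
  rw [← e, ← Matrix.mul_assoc, h.n_mul, Matrix.one_mul]

/-- `D 1 * N` solves the equation for `R`, so the minimal solution `M` lies below it and `V = D₀ + M
D₋₁ ≤ U`. Conversely `(1 - V)⁻¹ D₋₁` solves the equation for `G`; minimality of `G` gives `U ≤ V`.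
Hence `U = V`, and `M = D₁ (1 - V)⁻¹`. -/
theorem rateMatrix_eq [Nonempty S] :
    rateMatrix D = D 1 * (1 - (D 0 + D 1 * gMatrix D))⁻¹ := by
  set U := D 0 + D 1 * gMatrix D with hU
  set N := (1 - U)⁻¹ with hN
  have hNU : N * (1 - U) = 1 := h.n_mul
  have hG : gMatrix D = N * D (-1) := h.g_eq_n_mul
  have hN0 : ∀ a b, 0 ≤ N a b := h.n_nonneg
  have hR0 : ∀ a b, 0 ≤ (D 1 * N) a b := mul_apply_nonneg h.up_nonneg hN0
  have hU' : U = D 0 + D 1 * N * D (-1) := by rw [hU, hG, Matrix.mul_assoc]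
  have hReq : (D 1 * N) ^ 2 * D (-1) + D 1 * N * D 0 + D 1 = D 1 * N := by
    have e : D 1 * N - D 1 * N * U = D 1 := by
      rw [← Matrix.mul_one (D 1 * N), Matrix.mul_assoc (D 1 * N) 1 U, Matrix.one_mul,
        ← Matrix.mul_sub, Matrix.mul_assoc, hNU, Matrix.mul_one]
    have e2 : D 1 * N * U = D 1 * N * D 0 + (D 1 * N) ^ 2 * D (-1) := by
      conv_lhs => rw [hU']
      rw [Matrix.mul_add, sq, Matrix.mul_assoc (D 1 * N) (D 1 * N)]
    rw [sub_eq_iff_eq_add] at e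
    conv_rhs => rw [e, e2]
    abel
  have hmono : ∀ X Y : Matrix S S ℝ, (∀ a b, 0 ≤ X a b) → (∀ a b, X a b ≤ Y a b) → ∀ a b,
      (X ^ 2 * D (-1) + X * D 0 + D 1) a b ≤ (Y ^ 2 * D (-1) + Y * D 0 + D 1) a b := by
    intro X Y hX hXY a b
    have hY : ∀ a b, 0 ≤ Y a b := fun a b => (hX a b).trans (hXY a b)
    have h1 := mul_apply_le_mul_apply hXY (fun a b => le_refl (D 0 a b)) h.stay_nonneg hY a b
    have h2 := mul_apply_le_mul_apply hXY hXY hX hY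
    have h3 := mul_apply_le_mul_apply h2 (fun a b => le_refl (D (-1) a b)) h.down_nonneg
      (mul_apply_nonneg hY hY) a b
    simp only [sq, Matrix.add_apply]
    linarith
  obtain ⟨M, hM, hMR⟩ := exists_isMinNonnegSolution
    (F := fun X => X ^ 2 * D (-1) + X * D 0 + D 1)
    (P := fun X => ∀ a b, X a b ≤ (D 1 * N) a b) (B := D 1 * N) hmono (by fun_prop)
    (fun a b => by simpa using h.up_nonneg a b) hR0
    (fun X hX hP a b => by rw [← hReq]; exact hmono X _ hX hP a b)
    (by
      simp only [Set.ofPred_forall]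
      exact isClosed_iInter fun a => isClosed_iInter fun b =>
        isClosed_le (by fun_prop) continuous_const)
    (fun X _ hP => hP)
  have hrate : rateMatrix D = M := minNonnegSolution_eq hM
  rw [hrate]
  have hMeq : M ^ 2 * D (-1) + M * D 0 + D 1 = M := hM.2.1
  set V := D 0 + M * D (-1) with hV
  have hV0 : ∀ a b, 0 ≤ V a b := fun a b =>
    add_nonneg (h.stay_nonneg a b) (mul_apply_nonneg hM.1 h.down_nonneg a b)
  have hVU : ∀ a b, V a b ≤ U a b := fun a b => by
    rw [hU', hV, Matrix.add_apply, Matrix.add_apply]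
    exact add_le_add le_rfl (mul_apply_le_mul_apply hMR (fun a b => le_refl _) h.down_nonneg hR0 a b)
  have hVv : ∀ a, (V *ᵥ v) a < v a := fun a =>
    (mulVec_le_mulVec_of_le hVU (fun b => (h.pos b).le) a).trans_lt (h.u_mulVec_lt a)
  have hu := isUnit_one_sub hV0 h.pos hVv
  have hL0 := one_sub_inv_apply_nonneg hV0 h.pos hVv
  set L := (1 - V)⁻¹ with hL
  have hVL : (1 - V) * L = 1 := Matrix.mul_nonsing_inv _ hu
  have hML : M = D 1 * L := by
    have e : M * (1 - V) = D 1 := by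
      rw [Matrix.mul_sub, Matrix.mul_one, hV, Matrix.mul_add, ← Matrix.mul_assoc, ← sq]
      nth_rewrite 1 [← hMeq]
      abel
    rw [← e, Matrix.mul_assoc, hVL, Matrix.mul_one]
  have hVG : V = D 0 + D 1 * (L * D (-1)) := by rw [hV, hML, Matrix.mul_assoc]
  have hle := h.g_spec.1.2.2 (L * D (-1)) (mul_apply_nonneg hL0 h.down_nonneg) (by
    have e : (1 - V) * (L * D (-1)) = D (-1) := by rw [← Matrix.mul_assoc, hVL, Matrix.one_mul]
    rw [Matrix.sub_mul, Matrix.one_mul, sub_eq_iff_eq_add] at e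
    have e2 : V * (L * D (-1)) = D 0 * (L * D (-1)) + D 1 * (L * D (-1)) ^ 2 := by
      nth_rewrite 1 [hVG]
      rw [Matrix.add_mul, Matrix.mul_assoc (D 1), ← sq]
    rw [e2, ← add_assoc] at e
    exact e.symm)
  have hUV : U = V := by
    ext a b
    refine le_antisymm ?_ (hVU a b)
    rw [hVG, hU, Matrix.add_apply, Matrix.add_apply]
    exact add_le_add le_rfl (mul_apply_le_mul_apply (fun a b => le_refl _) hle h.g_nonneg
      h.up_nonneg a b)
  rw [hML, hL, hN, hUV]

theorem isUnit_k [Nonempty S] : IsUnit (1 - D 0 - D 1 - D 1 * gMatrix D).det := by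
  rw [← Matrix.isUnit_iff_isUnit_det]
  refine isUnit_of_mulVec_eq_zero fun x hx => ?_
  have e : D 0 *ᵥ x + D 1 *ᵥ x + D 1 *ᵥ (gMatrix D *ᵥ x) = x := by
    simp only [Matrix.sub_mulVec, Matrix.one_mulVec, ← Matrix.mulVec_mulVec] at hx
    rw [sub_sub, sub_sub, sub_eq_zero] at hx
    rw [add_assoc]; exact hx.symm
  funext a
  refine le_antisymm ?_ (h.nonneg_of_k_mulVec_nonneg (fun a => by rw [e]) a)
  have := h.nonneg_of_k_mulVec_nonneg (x := -x) (fun a => by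
    rw [Matrix.mulVec_neg, Matrix.mulVec_neg, Matrix.mulVec_neg, Matrix.mulVec_neg,
      ← neg_add, ← neg_add, e]) a
  simpa using this

/-- A Wiener–Hopf type factorisation of `K`, the link between the derivative of `G 1` and the factor
`(1 - R)⁻¹` in the drift. -/
theorem one_sub_rateMatrix_mul [Nonempty S] :
    (1 - rateMatrix D) * (1 - (D 0 + D 1 * gMatrix D)) = 1 - D 0 - D 1 - D 1 * gMatrix D := by
  rw [h.rateMatrix_eq, Matrix.sub_mul, Matrix.one_mul, Matrix.mul_assoc, h.n_mul, Matrix.mul_one]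
  abel

theorem rateMatrix_nonneg [Nonempty S] : ∀ a b, 0 ≤ rateMatrix D a b := by
  rw [h.rateMatrix_eq]; exact mul_apply_nonneg h.up_nonneg h.n_nonneg

/-- With `m = K⁻¹ 1 ≥ 0`, the vector `y = (1 - U) m = 1 + D₁ m` is positive and `(1 - R) y = K m =
1`. -/
theorem exists_rateMatrix_mulVec_lt [Nonempty S] :
    ∃ y : S → ℝ, (∀ a, 0 < y a) ∧ ∀ a, (rateMatrix D *ᵥ y) a < y a := by
  set K := 1 - D 0 - D 1 - D 1 * gMatrix D with hK
  have hm : K *ᵥ (K⁻¹ *ᵥ 1) = 1 := by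
    rw [Matrix.mulVec_mulVec, Matrix.mul_nonsing_inv _ h.isUnit_k, Matrix.one_mulVec]
  set m := K⁻¹ *ᵥ (1 : S → ℝ)
  have e : m = 1 + (D 0 *ᵥ m + D 1 *ᵥ m + D 1 *ᵥ (gMatrix D *ᵥ m)) := by
    rw [← hm, hK]
    simp only [Matrix.sub_mulVec, Matrix.one_mulVec, ← Matrix.mulVec_mulVec]
    abel
  have hm0 := h.nonneg_of_k_mulVec_nonneg (x := m) fun a => by
    have := congrFun e a
    simp only [Pi.add_apply, Pi.one_apply] at this ⊢
    linarith
  have hy : (1 - (D 0 + D 1 * gMatrix D)) *ᵥ m = 1 + D 1 *ᵥ m := by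
    simp only [Matrix.sub_mulVec, Matrix.add_mulVec, Matrix.one_mulVec, ← Matrix.mulVec_mulVec]
    nth_rewrite 1 [e]
    abel
  have hR : (1 - rateMatrix D) *ᵥ (1 + D 1 *ᵥ m) = 1 := by
    rw [← hy, Matrix.mulVec_mulVec, h.one_sub_rateMatrix_mul, hm]
  refine ⟨1 + D 1 *ᵥ m, fun a => ?_, fun a => ?_⟩
  · have := mulVec_apply_nonneg h.up_nonneg hm0 a
    simp only [Pi.add_apply, Pi.one_apply]
    linarith
  · have := congrFun hR a
    rw [Matrix.sub_mulVec, Matrix.one_mulVec, Pi.sub_apply, Pi.one_apply] at this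
    linarith

theorem n_mul_one_sub_rateMatrix_inv [Nonempty S] :
    (1 - (D 0 + D 1 * gMatrix D))⁻¹ * (1 - rateMatrix D)⁻¹ =
      (1 - D 0 - D 1 - D 1 * gMatrix D)⁻¹ := by
  rw [← h.one_sub_rateMatrix_mul, Matrix.mul_inv_rev]

end StableTriplet

end QuasiBirthDeath

/-! ### Stationary distributions of block tri-diagonal chains -/

section BlockTridiagonal

open Filter Topology

variable {S : Type*} [Fintype S]

theorem hasSum_of_finset_levels {f : ℕ × S → ℝ} (F : Finset ℕ)
    (hF : ∀ i ∉ F, ∀ a, f (i, a) = 0) {s : ℝ} (hs : ∑ i ∈ F, ∑ a, f (i, a) = s) :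
    HasSum f s := by
  rw [← hs, ← Finset.sum_product' F Finset.univ fun i a => f (i, a)]
  refine hasSum_sum_of_ne_finset_zero fun x hx => hF x.1 (fun h => hx ?_) x.2
  exact Finset.mem_product.2 ⟨h, Finset.mem_univ _⟩

theorem hasSum_blockTridiagonal_zero (B D : ℤ → Matrix S S ℝ) (σ : ℕ → S → ℝ) (b : S) :
    HasSum (fun x => σ x.1 x.2 * blockTridiagonal B D x (0, b))
      ((σ 0 ᵥ* B 0 + σ 1 ᵥ* D (-1)) b) := by
  refine hasSum_of_finset_levels {0, 1} (fun i hi a => ?_) ?_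
  · simp only [Finset.mem_insert, Finset.mem_singleton, not_or] at hi
    have : ¬ ((-(i : ℤ)) ∈ stepH) := by simp [stepH]; omega
    simp only [blockTridiagonal, Nat.cast_zero, zero_sub, this, hi.1, if_false, mul_zero]
  · simp [blockTridiagonal, stepH, stepHPlus, Matrix.vecMul, dotProduct]

theorem hasSum_blockTridiagonal_one (B D : ℤ → Matrix S S ℝ) (σ : ℕ → S → ℝ) (b : S) :
    HasSum (fun x => σ x.1 x.2 * blockTridiagonal B D x (1, b))
      ((σ 0 ᵥ* B 1 + σ 1 ᵥ* D 0 +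
        σ 2 ᵥ* D (-1)) b) := by
  refine hasSum_of_finset_levels {0, 1, 2} (fun i hi a => ?_) ?_
  · simp only [Finset.mem_insert, Finset.mem_singleton, not_or] at hi
    have : ¬ ((1 - (i : ℤ)) ∈ stepH) := by simp [stepH]; omega
    simp only [blockTridiagonal, Nat.cast_one, this, hi.1, if_false, mul_zero]
  · simp [blockTridiagonal, stepH, stepHPlus, Matrix.vecMul, dotProduct, add_assoc]

theorem hasSum_blockTridiagonal_add_two (B D : ℤ → Matrix S S ℝ) (σ : ℕ → S → ℝ) (k : ℕ)
    (b : S) : HasSum (fun x => σ x.1 x.2 * blockTridiagonal B D x (k + 2, b))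
      ((σ (k + 1) ᵥ* D 1 + σ (k + 2) ᵥ* D 0 +
        σ (k + 3) ᵥ* D (-1)) b) := by
  refine hasSum_of_finset_levels {k + 1, k + 2, k + 3} (fun i hi a => ?_) ?_
  · simp only [Finset.mem_insert, Finset.mem_singleton, not_or] at hi
    have h1 : ¬ (((k + 2 : ℕ) : ℤ) - (i : ℤ) ∈ stepH) := by simp [stepH]; omega
    have h2 : ¬ (((k + 2 : ℕ) : ℤ) - (i : ℤ) ∈ stepHPlus) := by simp [stepHPlus]; omega
    simp only [blockTridiagonal, h1, h2, if_false, ite_self, mul_zero]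
  · have e1 : ((k + 2 : ℕ) : ℤ) - ((k + 1 : ℕ) : ℤ) = 1 := by push_cast; ring
    have e2 : ((k + 2 : ℕ) : ℤ) - ((k + 2 : ℕ) : ℤ) = 0 := by ring
    have e3 : ((k + 2 : ℕ) : ℤ) - ((k + 3 : ℕ) : ℤ) = -1 := by push_cast; ring
    rw [Finset.sum_insert (by simp), Finset.sum_insert (by simp), Finset.sum_singleton]
    simp only [blockTridiagonal, e1, e2, e3]
    simp [stepH, Matrix.vecMul, dotProduct, add_assoc]

namespace StableTriplet

variable [DecidableEq S] {D : ℤ → Matrix S S ℝ} {w ρ : ℝ} {v : S → ℝ} (h : StableTriplet D w ρ v)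
variable {B : ℤ → Matrix S S ℝ}

include h

theorem censored_nonneg (hB0 : ∀ a b, 0 ≤ B 0 a b) (hB1 : ∀ a b, 0 ≤ B 1 a b) :
    ∀ a b, 0 ≤ (B 0 + B 1 * gMatrix D) a b := fun a b =>
  add_nonneg (hB0 a b) (mul_apply_nonneg hB1 h.g_nonneg a b)

variable [Nonempty S]

theorem censored_mulVec_one (hB : B 0 *ᵥ 1 + B 1 *ᵥ 1 = 1) :
    (B 0 + B 1 * gMatrix D) *ᵥ 1 = 1 := by
  rw [Matrix.add_mulVec, ← Matrix.mulVec_mulVec, h.g_mulVec_one, hB]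

theorem up_mul_g : D 1 * gMatrix D = rateMatrix D * D (-1) := by
  conv_lhs => rw [h.g_eq_n_mul, ← Matrix.mul_assoc, ← h.rateMatrix_eq]

/-- The stationary distribution of the block tri-diagonal chain exists (matrix geometric form). -/
theorem exists_isStationaryDistribution (hB0 : ∀ a b, 0 ≤ B 0 a b) (hB1 : ∀ a b, 0 ≤ B 1 a b)
    (hB : B 0 *ᵥ 1 + B 1 *ᵥ 1 = 1) :
    ∃ π, IsStationaryDistribution (blockTridiagonal B D) π := by
  obtain ⟨u, hu0, hu1, hu⟩ := exists_stationary_vector (h.censored_nonneg hB0 hB1)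
    (h.censored_mulVec_one hB)
  set N := (1 - (D 0 + D 1 * gMatrix D))⁻¹ with hN
  have hG : gMatrix D = N * D (-1) := h.g_eq_n_mul
  have hR : rateMatrix D = D 1 * N := h.rateMatrix_eq
  have hNU : N = 1 + N * (D 0 + D 1 * gMatrix D) := by
    have := h.n_mul
    rw [Matrix.mul_sub, Matrix.mul_one, sub_eq_iff_eq_add] at this
    exact this
  obtain ⟨t, ht⟩ : ∃ t, t = u ᵥ* (B 1 * N) := ⟨_, rfl⟩
  have ht0 : ∀ a, 0 ≤ t a := ht ▸ vecMul_apply_nonneg (mul_apply_nonneg hB1 h.n_nonneg) hu0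
  -- The unnormalised candidate: `u` at level `0` and `u B₁ N R ^ k` at level `k + 1`.
  obtain ⟨σ, hσ0, hσ⟩ : ∃ σ : ℕ → S → ℝ,
      σ 0 = u ∧ ∀ k, σ (k + 1) = t ᵥ* rateMatrix D ^ k :=
    ⟨fun k => Nat.casesOn k u fun k => t ᵥ* rateMatrix D ^ k, rfl, fun _ => rfl⟩
  have hσ1 : σ 1 = t := by rw [← zero_add 1, hσ, pow_zero, Matrix.vecMul_one]
  have hσR : ∀ k, σ (k + 2) = σ (k + 1) ᵥ* rateMatrix D := fun k => by
    rw [hσ, hσ, pow_succ, Matrix.vecMul_vecMul]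
  let π : ℕ × S → ℝ := fun x => σ x.1 x.2
  have hnn : ∀ x, 0 ≤ π x := by
    rintro ⟨_ | k, a⟩
    · simpa [π, hσ0] using hu0 a
    · simp only [π, hσ]
      exact vecMul_apply_nonneg (pow_apply_nonneg h.rateMatrix_nonneg k) ht0 a
  -- Weighting by `y` makes `R` a strict contraction, which dominates the masses of the levels by a
  -- geometric series.
  obtain ⟨y, hy, hRy⟩ := h.exists_rateMatrix_mulVec_lt
  obtain ⟨r, hr0, hr1, hr⟩ := exists_lt_one_mulVec_le h.rateMatrix_nonneg hy hRy
  have hsum : Summable π := by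
    rw [summable_prod_of_nonneg hnn]
    refine ⟨fun k => Summable.of_finite, ?_⟩
    simp only [tsum_fintype]
    refine summable_sum fun a _ => (summable_nat_add_iff 1).1 ?_
    refine Summable.of_nonneg_of_le (fun k => hnn (k + 1, a)) (fun k => ?_)
      ((summable_geometric_of_lt_one hr0 hr1).mul_left ((t ⬝ᵥ y) / y a))
    simp only [π, hσ]
    rw [div_mul_eq_mul_div, le_div_iff₀ (hy a)]
    calc (t ᵥ* rateMatrix D ^ k) a * y a ≤ (t ᵥ* rateMatrix D ^ k) ⬝ᵥ y :=
          Finset.single_le_sum (f := fun a => (t ᵥ* rateMatrix D ^ k) a * y a)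
            (fun b _ => mul_nonneg
              (vecMul_apply_nonneg (pow_apply_nonneg h.rateMatrix_nonneg k) ht0 b) (hy b).le) (Finset.mem_univ a)
      _ = t ⬝ᵥ (rateMatrix D ^ k *ᵥ y) := (Matrix.dotProduct_mulVec _ _ _).symm
      _ ≤ t ⬝ᵥ (r ^ k • y) := Finset.sum_le_sum fun b _ => mul_le_mul_of_nonneg_left
          (pow_mulVec_le h.rateMatrix_nonneg hr0 hr k b) (ht0 b)
      _ = t ⬝ᵥ y * r ^ k := by rw [dotProduct_smul, smul_eq_mul, mul_comm]
  have hpos : 0 < ∑' x, π x := by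
    obtain ⟨a, ha⟩ : ∃ a, 0 < u a := by
      by_contra hcon
      push Not at hcon
      have := Finset.sum_nonpos fun a (_ : a ∈ Finset.univ) => hcon a
      linarith
    exact hsum.tsum_pos hnn (0, a) (by simpa [π, hσ0] using ha)
  have hbal : ∀ x, HasSum (fun z => π z * blockTridiagonal B D z x) (π x) := by
    have e : rateMatrix D = D 1 + rateMatrix D * (D 0 + D 1 * gMatrix D) := by
      conv_lhs => rw [hR, hNU, Matrix.mul_add, Matrix.mul_one, ← Matrix.mul_assoc, ← hR]
    have b0 : σ 0 ᵥ* B 0 + σ 1 ᵥ* D (-1) = σ 0 := by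
      rw [hσ0, hσ1, ht, Matrix.vecMul_vecMul, Matrix.mul_assoc, ← hG, ← Matrix.vecMul_add, hu]
    have b1 : σ 0 ᵥ* B 1 + σ 1 ᵥ* D 0 + σ 2 ᵥ* D (-1) = σ 1 := by
      rw [show σ 2 = σ 1 ᵥ* rateMatrix D from hσR 0, hσ0, hσ1, Matrix.vecMul_vecMul, ← h.up_mul_g, add_assoc,
        ← Matrix.vecMul_add]
      conv_rhs => rw [ht, hNU, Matrix.mul_add, Matrix.mul_one, ← Matrix.mul_assoc,
        Matrix.vecMul_add, ← Matrix.vecMul_vecMul u (B 1 * N), ← ht]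
    have b2 : ∀ k, σ (k + 1) ᵥ* D 1 + σ (k + 2) ᵥ* D 0 + σ (k + 3) ᵥ* D (-1) = σ (k + 2) :=
      fun k => by
        rw [show σ (k + 3) = σ (k + 2) ᵥ* rateMatrix D from hσR (k + 1), Matrix.vecMul_vecMul _ (rateMatrix D), ← h.up_mul_g, add_assoc, ← Matrix.vecMul_add,
          hσR k, Matrix.vecMul_vecMul, ← Matrix.vecMul_add, ← e]
    rintro ⟨_ | _ | k, b⟩
    · have := hasSum_blockTridiagonal_zero B D σ b
      rwa [b0] at this
    · have := hasSum_blockTridiagonal_one B D σ b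
      rwa [b1] at this
    · have := hasSum_blockTridiagonal_add_two B D σ k b
      rwa [b2] at this
  refine ⟨fun x => (∑' x, π x)⁻¹ * π x, fun x => mul_nonneg (inv_nonneg.2 hpos.le) (hnn x), ?_,
    fun x => ?_⟩
  · have := hsum.hasSum.mul_left (∑' x, π x)⁻¹
    rwa [inv_mul_cancel₀ hpos.ne'] at this
  · simpa only [mul_assoc] using (hbal x).mul_left (∑' x, π x)⁻¹

/-- Because `N D₋₁ = G`, the powers regroup as `D₋₁ G ^ n N`, and the stochastic `G` cannot enlarge
the bound on `N 1`. -/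
theorem exists_pow_down_mul_n_bound :
    ∃ c, ∀ n a, ((D (-1) * (1 - (D 0 + D 1 * gMatrix D))⁻¹) ^ (n + 1) *ᵥ 1) a ≤ c := by
  set N := (1 - (D 0 + D 1 * gMatrix D))⁻¹ with hN
  have hG : gMatrix D = N * D (-1) := h.g_eq_n_mul
  obtain ⟨c, hc, hc1⟩ := exists_le_mul_of_pos (N *ᵥ 1) (v := (1 : S → ℝ)) (by simp)
  have hGX : ∀ X, gMatrix D * X = N * (D (-1) * X) := fun X => by rw [← Matrix.mul_assoc, ← hG]
  have hpow : ∀ n, (D (-1) * N) ^ (n + 1) = D (-1) * (gMatrix D ^ n * N) := by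
    intro n
    induction n with
    | zero => simp
    | succ n ih =>
      rw [pow_succ', ih, pow_succ' (gMatrix D)]
      simp only [Matrix.mul_assoc]
      rw [hGX]
  refine ⟨c, fun n a => ?_⟩
  rw [hpow, ← Matrix.mulVec_mulVec, ← Matrix.mulVec_mulVec]
  have h1 : ∀ a, (N *ᵥ 1) a ≤ (c • (1 : S → ℝ)) a := fun a => by
    simpa using (le_abs_self _).trans (hc1 a)
  have h2 := mulVec_le_mulVec_of_nonneg (pow_apply_nonneg h.g_nonneg n) h1
  rw [Matrix.mulVec_smul, pow_mulVec_eq_self h.g_mulVec_one] at h2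
  refine (mulVec_le_mulVec_of_nonneg h.down_nonneg h2 a).trans ?_
  have h3 := congrFun h.stochastic a
  have h4 := mulVec_apply_nonneg h.stay_nonneg (v := 1) (by simp) a
  have h5 := mulVec_apply_nonneg h.up_nonneg (v := 1) (by simp) a
  simp only [Pi.add_apply, Pi.one_apply] at h3
  rw [Matrix.mulVec_smul, Pi.smul_apply, smul_eq_mul]
  nlinarith

/-- A sequence of row vectors tending to `0` that is propagated backwards by `D (-1) * N`
vanishes. -/
theorem eq_zero_of_backward {δ : ℕ → S → ℝ} (hδ : ∀ a, Tendsto (fun k => δ k a) atTop (𝓝 0))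
    (hrec : ∀ k, δ k = δ (k + 1) ᵥ* (D (-1) * (1 - (D 0 + D 1 * gMatrix D))⁻¹)) (k : ℕ) :
    δ k = 0 := by
  obtain ⟨c, hc⟩ := h.exists_pow_down_mul_n_bound
  set W := D (-1) * (1 - (D 0 + D 1 * gMatrix D))⁻¹
  have hW : ∀ a b, 0 ≤ W a b := mul_apply_nonneg h.down_nonneg h.n_nonneg
  have hiter : ∀ n, δ k = δ (k + n) ᵥ* W ^ n := by
    intro n
    induction n with
    | zero => simp
    | succ n ih =>
      conv_lhs => rw [ih, hrec (k + n)]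
      rw [Matrix.vecMul_vecMul, ← pow_succ', add_assoc]
  have hbound : ∀ n b, |δ k b| ≤ ∑ a, |δ (k + (n + 1)) a| * c := fun n b => by
    conv_lhs => rw [hiter (n + 1)]
    refine (Finset.abs_sum_le_sum_abs _ _).trans (Finset.sum_le_sum fun a _ => ?_)
    rw [abs_mul]
    refine mul_le_mul_of_nonneg_left ?_ (abs_nonneg _)
    rw [abs_of_nonneg (pow_apply_nonneg hW _ a b)]
    simpa using apply_le_of_mulVec_le (v := 1) (w := fun _ => c) (pow_apply_nonneg hW (n + 1))
      (by simp) (hc n) a b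
  funext b
  have hlim : Tendsto (fun n => ∑ a, |δ (k + (n + 1)) a| * c) atTop (𝓝 0) := by
    rw [show (0 : ℝ) = ∑ _a : S, |(0 : ℝ)| * c by simp]
    refine tendsto_finsetSum _ fun a _ => Tendsto.mul_const c (Tendsto.abs ?_)
    have := (tendsto_add_atTop_iff_nat (k + 1)).2 (hδ a)
    exact this.congr fun n => by rw [show n + (k + 1) = k + (n + 1) by ring]
  have := ge_of_tendsto' hlim fun n => hbound n b
  exact abs_eq_zero.1 (le_antisymm this (abs_nonneg _))

/-- Every stationary distribution of the block tri-diagonal chain has matrix geometric form. -/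
theorem stationary_form {π : ℕ × S → ℝ}
    (hπ : IsStationaryDistribution (blockTridiagonal B D) π) :
    (fun a => π (0, a)) ᵥ* (B 0 + B 1 * gMatrix D) = (fun a => π (0, a)) ∧
    (fun a => π (1, a)) =
      (fun a => π (0, a)) ᵥ* (B 1 * (1 - (D 0 + D 1 * gMatrix D))⁻¹) ∧
    0 < ∑ a, π (0, a) := by
  obtain ⟨hnn, hone, hbal⟩ := hπ
  set p : ℕ → S → ℝ := fun k a => π (k, a) with hp
  have b0 : p 0 = p 0 ᵥ* B 0 + p 1 ᵥ* D (-1) := funext fun b =>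
    (hbal (0, b)).unique (hasSum_blockTridiagonal_zero B D p b)
  have b1 : p 1 = p 0 ᵥ* B 1 + p 1 ᵥ* D 0 + p 2 ᵥ* D (-1) := funext fun b =>
    (hbal (1, b)).unique (hasSum_blockTridiagonal_one B D p b)
  have b2 : ∀ k, p (k + 2) = p (k + 1) ᵥ* D 1 + p (k + 2) ᵥ* D 0 + p (k + 3) ᵥ* D (-1) :=
    fun k => funext fun b =>
      (hbal (k + 2, b)).unique (hasSum_blockTridiagonal_add_two B D p k b)
  set U := D 0 + D 1 * gMatrix D with hU
  set N := (1 - U)⁻¹ with hN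
  have hG : gMatrix D = N * D (-1) := h.g_eq_n_mul
  have hR : rateMatrix D = D 1 * N := h.rateMatrix_eq
  have hUN : (1 - U) * N = 1 := h.mul_n
  have hUR : U = D 0 + rateMatrix D * D (-1) := by rw [hU, h.up_mul_g]
  -- The defect from matrix geometric form. The balance equations propagate it backwards through
  -- `D₋₁ N`, and it tends to zero by summability, so it vanishes.
  let δ : ℕ → S → ℝ := fun k =>
    Nat.casesOn k (p 1 - p 0 ᵥ* (B 1 * N)) fun k => p (k + 2) - p (k + 1) ᵥ* rateMatrix D
  have d0 : δ 0 = p 1 - p 0 ᵥ* (B 1 * N) := rfl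
  have dk : ∀ k, δ (k + 1) = p (k + 2) - p (k + 1) ᵥ* rateMatrix D := fun _ => rfl
  have solve : ∀ {x y z : S → ℝ}, x = y + x ᵥ* D 0 + z ᵥ* D (-1) →
      x - y ᵥ* N = (z - x ᵥ* rateMatrix D) ᵥ* (D (-1) * N) := fun {x y z} hx => by
    have e : x ᵥ* (1 - U) = y + (z - x ᵥ* rateMatrix D) ᵥ* D (-1) := by
      rw [Matrix.vecMul_sub, Matrix.vecMul_one, hUR, Matrix.vecMul_add, Matrix.sub_vecMul,
        Matrix.vecMul_vecMul]
      nth_rewrite 1 [hx]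
      abel
    rw [← Matrix.vecMul_vecMul, ← sub_eq_iff_eq_add'.2 e, Matrix.sub_vecMul,
      Matrix.vecMul_vecMul, hUN, Matrix.vecMul_one]
  have hrec : ∀ k, δ k = δ (k + 1) ᵥ* (D (-1) * N) := by
    rintro (_ | k)
    · rw [d0, dk, ← solve b1, Matrix.vecMul_vecMul]
    · rw [dk, dk, ← solve (b2 k), Matrix.vecMul_vecMul, hR]
  have hp0 : ∀ a, Tendsto (fun k => p k a) atTop (𝓝 0) := fun a =>
    (hone.summable.comp_injective (i := fun k : ℕ => (k, a)) fun i j hij =>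
      (Prod.mk.inj hij).1).tendsto_atTop_zero
  have hδ : ∀ a, Tendsto (fun k => δ k a) atTop (𝓝 0) := fun a => by
    rw [← tendsto_add_atTop_iff_nat 1]
    have h1 : Tendsto (fun k => (p (k + 1) ᵥ* rateMatrix D) a) atTop (𝓝 0) := by
      rw [show (0 : ℝ) = ∑ c, 0 * rateMatrix D c a by simp]
      exact tendsto_finsetSum _ fun c _ =>
        ((tendsto_add_atTop_iff_nat 1).2 (hp0 c)).mul_const _
    have h2 := ((tendsto_add_atTop_iff_nat 2).2 (hp0 a)).sub h1
    rwa [sub_zero] at h2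
  have hzero := h.eq_zero_of_backward hδ hrec
  have f1 : p 1 = p 0 ᵥ* (B 1 * N) := sub_eq_zero.1 ((d0).symm.trans (hzero 0))
  have fk : ∀ k, p (k + 2) = p (k + 1) ᵥ* rateMatrix D := fun k =>
    sub_eq_zero.1 ((dk k).symm.trans (hzero (k + 1)))
  refine ⟨?_, f1, ?_⟩
  · change p 0 ᵥ* _ = p 0
    conv_rhs => rw [b0, f1, Matrix.vecMul_vecMul, Matrix.mul_assoc, ← hG, ← Matrix.vecMul_add]
  -- Without mass at level `0` the geometric form leaves no mass anywhere.
  · by_contra hcon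
    have hz : p 0 = 0 := by
      funext a
      refine le_antisymm (le_trans ?_ (not_lt.1 hcon)) (hnn (0, a))
      exact Finset.single_le_sum (f := fun a => π (0, a)) (fun b _ => hnn (0, b))
        (Finset.mem_univ a)
    have hz1 : ∀ k, p (k + 1) = 0 := by
      intro k
      induction k with
      | zero => rw [f1, hz, Matrix.zero_vecMul]
      | succ k ih => rw [fk, ih, Matrix.zero_vecMul]
    have hπ0 : π = 0 := by
      funext ⟨k, a⟩
      cases k with
      | zero => exact congrFun hz a
      | succ k => exact congrFun (hz1 k) a
    rw [hπ0] at hone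
    exact zero_ne_one (hasSum_zero.unique hone)

end StableTriplet

end BlockTridiagonal

/-! ### Perturbation of the G-matrix and of the censored boundary block -/

section Perturbation

open Filter Topology

theorem continuousAt_of_forall_hasDerivAt {M : ℝ → Matrix S S ℝ} {M' : Matrix S S ℝ}
    (hM : ∀ a b, HasDerivAt (fun z => M z a b) (M' a b) x) : ContinuousAt M x :=
  continuousAt_pi.2 fun a => continuousAt_pi.2 fun b => (hM a b).continuousAt

variable {S : Type*} [Fintype S] [DecidableEq S]

/-- A strict Lyapunov inequality over finitely many phases persists for nearby parameters with the
same `w` and `v`. -/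
theorem eventually_gMatrix_spec {D : ℝ → ℤ → Matrix S S ℝ} {x : ℝ}
    (hnn : ∀ᶠ z in 𝓝 x, ∀ j ∈ stepH, ∀ a b, 0 ≤ D z j a b)
    (hcont : ∀ j, ContinuousAt (fun z => D z j) x) {w : ℝ} (hw : 0 ≤ w) {v : S → ℝ}
    (hv : ∀ a, 0 < v a)
    (h : ∀ a, (D x (-1) *ᵥ v) a + w * (D x 0 *ᵥ v) a + w ^ 2 * (D x 1 *ᵥ v) a < w * v a) :
    ∀ᶠ z in 𝓝 x, IsMinNonnegSolution
      (fun M => D z (-1) + D z 0 * M + D z 1 * M ^ 2 = M) (gMatrix (D z)) ∧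
      ∀ a, (gMatrix (D z) *ᵥ v) a ≤ w * v a := by
  have hc : ∀ j a, ContinuousAt (fun z => (D z j *ᵥ v) a) x := fun j a =>
    ContinuousAt.comp (g := fun M : Matrix S S ℝ => (M *ᵥ v) a)
      (Continuous.continuousAt (by fun_prop)) (hcont j)
  have hev : ∀ᶠ z in 𝓝 x, ∀ a, (D z (-1) *ᵥ v) a + w * (D z 0 *ᵥ v) a +
      w ^ 2 * (D z 1 *ᵥ v) a < w * v a := by
    rw [eventually_all]
    intro a
    exact (((hc (-1) a).add ((hc 0 a).const_mul w)).add
      ((hc 1 a).const_mul (w ^ 2))).tendsto.eventually_lt_const (h a)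
  filter_upwards [hnn, hev] with z hz hlt
  exact gMatrix_spec (hz _ (by simp [stepH])) (hz _ (by simp [stepH])) (hz _ (by simp [stepH]))
    hw hv fun a => (hlt a).le

variable [Nonempty S]

/-- A negative mean drift yields Lyapunov functions close to the constant one. -/
theorem exists_eventually_lyapunov {D : ℤ → Matrix S S ℝ} (hnn : ∀ j ∈ stepH, ∀ a b, 0 ≤ D j a b)
    (h1 : D (-1) *ᵥ 1 + D 0 *ᵥ 1 + D 1 *ᵥ 1 = 1)
    (hker : ∀ x, (D (-1) + D 0 + D 1) *ᵥ x = x → ∃ c : ℝ, x = fun _ => c)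
    (hdrift : stationaryDistribution (D (-1) + D 0 + D 1) ⬝ᵥ ((-D (-1) + D 1) *ᵥ 1) < 0) :
    ∃ h : S → ℝ, ∀ᶠ ε in 𝓝[>] (0 : ℝ), (∀ a, 0 < (1 + ε • h) a) ∧
      ∀ a, (D (-1) *ᵥ (1 + ε • h)) a + (1 + ε) * (D 0 *ᵥ (1 + ε • h)) a +
        (1 + ε) ^ 2 * (D 1 *ᵥ (1 + ε • h)) a < (1 + ε) * (1 + ε • h) a := by
  obtain ⟨hu1, hu⟩ := stationaryDistribution_spec_of_fintype (M := D (-1) + D 0 + D 1)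
    (fun a b => add_nonneg (add_nonneg (hnn _ (by simp [stepH]) a b) (hnn _ (by simp [stepH]) a b))
      (hnn _ (by simp [stepH]) a b)) (by rw [Matrix.add_mulVec, Matrix.add_mulVec, h1])
  set u := stationaryDistribution (D (-1) + D 0 + D 1)
  set d : S → ℝ := (-D (-1) + D 1) *ᵥ 1 with hd
  set κ := u ⬝ᵥ d with hκ
  have hu1' : u ⬝ᵥ (1 : S → ℝ) = 1 := by simpa [dotProduct] using hu1
  obtain ⟨h, hh⟩ := exists_sub_mulVec_eq hker hu1 hu (d := d - κ • 1) (by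
    rw [dotProduct_sub, dotProduct_smul, hu1', smul_eq_mul, mul_one, sub_self])
  refine ⟨h, ?_⟩
  rw [eventually_and, eventually_all, eventually_all]
  constructor
  · intro a
    have hc : Continuous fun ε : ℝ => (1 + ε • h) a := by fun_prop
    exact (hc.tendsto 0).mono_left nhdsWithin_le_nhds |>.eventually_const_lt (by simp)
  · intro a
    -- The two sides of the Lyapunov inequality differ by exactly `ε * g ε`, and `g 0 = κ` is the
    -- negative drift.
    set g : ℝ → ℝ := fun ε => κ + ε * ((D 0 *ᵥ h) a + (D 1 *ᵥ 1) a + 2 * (D 1 *ᵥ h) a - h a +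
      ε * (D 1 *ᵥ h) a) with hg
    have hgc : Continuous g := by fun_prop
    have hneg : ∀ᶠ ε in 𝓝[>] (0 : ℝ), g ε < 0 :=
      (hgc.tendsto 0).mono_left nhdsWithin_le_nhds |>.eventually_lt_const (by simpa [hg] using hdrift)
    filter_upwards [hneg, self_mem_nhdsWithin] with ε hε hpos
    have e1 := congrFun h1 a
    have e2 := congrFun hh a
    simp only [hd, Matrix.add_mulVec, Matrix.neg_mulVec, Pi.add_apply, Pi.sub_apply, Pi.neg_apply,
      Pi.smul_apply, Pi.one_apply, smul_eq_mul, mul_one] at e1 e2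
    simp only [Matrix.mulVec_add, Matrix.mulVec_smul, Pi.add_apply, Pi.smul_apply, Pi.one_apply,
      smul_eq_mul]
    have key : (D (-1) *ᵥ 1) a + ε * (D (-1) *ᵥ h) a +
        (1 + ε) * ((D 0 *ᵥ 1) a + ε * (D 0 *ᵥ h) a) +
        (1 + ε) ^ 2 * ((D 1 *ᵥ 1) a + ε * (D 1 *ᵥ h) a) - (1 + ε) * (1 + ε * h a) = ε * g ε := by
      have e3 : κ = -(D (-1) *ᵥ 1) a + (D 1 *ᵥ 1) a - h a +
          ((D (-1) *ᵥ h) a + (D 0 *ᵥ h) a + (D 1 *ᵥ h) a) := by linarith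
      have e4 : (D 0 *ᵥ 1) a = 1 - (D (-1) *ᵥ 1) a - (D 1 *ᵥ 1) a := by linarith
      simp only [hg]
      rw [e3, e4]
      ring
    have := mul_neg_of_pos_of_neg (Set.mem_Ioi.1 hpos) hε
    linarith

/-- Fix one small `ε` and take `w = 1 + ε`, `v = 1 + ε • h`; finiteness of the phase set turns the
strict inequality into a uniform rate. -/
theorem exists_stableTriplet {D : ℤ → Matrix S S ℝ} (hnn : ∀ j ∈ stepH, ∀ a b, 0 ≤ D j a b)
    (h1 : D (-1) *ᵥ 1 + D 0 *ᵥ 1 + D 1 *ᵥ 1 = 1)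
    (hker : ∀ x, (D (-1) + D 0 + D 1) *ᵥ x = x → ∃ c : ℝ, x = fun _ => c)
    (hdrift : stationaryDistribution (D (-1) + D 0 + D 1) ⬝ᵥ ((-D (-1) + D 1) *ᵥ 1) < 0) :
    ∃ w ρ v, StableTriplet D w ρ v := by
  obtain ⟨h, hh⟩ := exists_eventually_lyapunov hnn h1 hker hdrift
  obtain ⟨ε, ⟨hv, hlt⟩, hε⟩ := (hh.and self_mem_nhdsWithin).exists
  have hε0 : 0 < ε := hε
  have hm := hnn (-1) (by simp [stepH])
  have hs := hnn 0 (by simp [stepH])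
  have hp := hnn 1 (by simp [stepH])
  have hw : 0 < 1 + ε := by linarith
  have hmul : ∀ a, (((1 + ε)⁻¹ • (D (-1) + (1 + ε) • D 0 + (1 + ε) ^ 2 • D 1)) *ᵥ (1 + ε • h)) a =
      (1 + ε)⁻¹ * ((D (-1) *ᵥ (1 + ε • h)) a + (1 + ε) * (D 0 *ᵥ (1 + ε • h)) a +
        (1 + ε) ^ 2 * (D 1 *ᵥ (1 + ε • h)) a) := fun a => by
    simp only [Matrix.smul_mulVec, Matrix.add_mulVec, Pi.smul_apply, Pi.add_apply, smul_eq_mul]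
  obtain ⟨r, hr0, hr1, hr⟩ := exists_lt_one_mulVec_le
    (M := (1 + ε)⁻¹ • (D (-1) + (1 + ε) • D 0 + (1 + ε) ^ 2 • D 1)) (fun a b => by
      simp only [Matrix.smul_apply, Matrix.add_apply, smul_eq_mul]
      exact mul_nonneg (inv_nonneg.2 hw.le) (add_nonneg (add_nonneg (hm a b)
        (mul_nonneg hw.le (hs a b))) (mul_nonneg (sq_nonneg _) (hp a b)))) hv (fun a => by
      rw [hmul, inv_mul_lt_iff₀ hw]
      exact hlt a)
  exact ⟨1 + ε, r, 1 + ε • h, hm, hs, hp, h1, by linarith, hr0, hr1, hv, fun a => by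
    have := hr a
    rw [hmul, inv_mul_le_iff₀ hw] at this
    linarith⟩

variable {D : ℝ → ℤ → Matrix S S ℝ} {x : ℝ}

/-- The G-matrix depends continuously on the triplet at a stochastic triplet with negative
drift. -/
theorem continuousAt_gMatrix
    (hnn : ∀ᶠ z in 𝓝 x, ∀ j ∈ stepH, ∀ a b, 0 ≤ D z j a b)
    (hcont : ∀ j, ContinuousAt (fun z => D z j) x)
    (h1 : D x (-1) *ᵥ 1 + D x 0 *ᵥ 1 + D x 1 *ᵥ 1 = 1)
    (hker : ∀ y, (D x (-1) + D x 0 + D x 1) *ᵥ y = y → ∃ c : ℝ, y = fun _ => c)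
    (hdrift : stationaryDistribution (D x (-1) + D x 0 + D x 1) ⬝ᵥ
      ((-D x (-1) + D x 1) *ᵥ 1) < 0) :
    (∀ᶠ z in 𝓝 x, IsMinNonnegSolution
      (fun M => D z (-1) + D z 0 * M + D z 1 * M ^ 2 = M) (gMatrix (D z))) ∧
    ContinuousAt (fun z => gMatrix (D z)) x := by
  obtain ⟨w, ρ, v, hst⟩ := exists_stableTriplet hnn.self_of_nhds h1 hker hdrift
  obtain ⟨h, hh⟩ := exists_eventually_lyapunov hnn.self_of_nhds h1 hker hdrift
  have hG : ∀ᶠ ε in 𝓝[>] (0 : ℝ), (∀ a, 0 < (1 + ε • h) a) ∧ ∀ᶠ z in 𝓝 x, IsMinNonnegSolution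
      (fun M => D z (-1) + D z 0 * M + D z 1 * M ^ 2 = M) (gMatrix (D z)) ∧
      ∀ a, (gMatrix (D z) *ᵥ (1 + ε • h)) a ≤ (1 + ε) * (1 + ε • h) a := by
    filter_upwards [hh, self_mem_nhdsWithin] with ε hε hpos
    have : (0 : ℝ) < ε := hpos
    exact ⟨hε.1, eventually_gMatrix_spec hnn hcont (by linarith) hε.1 hε.2⟩
  obtain ⟨ε₀, hv₀, hG₀⟩ := hG.exists
  have hmin := hG₀.mono fun z hz => hz.1
  refine ⟨hmin, tendsto_iff_ultrafilter _ _ _ |>.2 fun g hg => ?_⟩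
  let K : Set (Matrix S S ℝ) := Set.pi Set.univ fun a => Set.pi Set.univ fun b =>
    Set.Icc 0 ((1 + ε₀) * (1 + ε₀ • h) a / (1 + ε₀ • h) b)
  have hK : IsCompact K := isCompact_univ_pi fun a => isCompact_univ_pi fun b => isCompact_Icc
  have hGK : ∀ᶠ z in 𝓝 x, gMatrix (D z) ∈ K := by
    filter_upwards [hG₀] with z hz
    exact fun a _ b _ => ⟨hz.1.1 a b, apply_le_of_mulVec_le hz.1.1 hv₀ hz.2 a b⟩
  obtain ⟨X, hXK, hX⟩ := hK.ultrafilter_le_nhds (g.map fun z => gMatrix (D z))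
    (le_principal_iff.2 (hg hGK))
  have hX : Tendsto (fun z => gMatrix (D z)) g (𝓝 X) := hX
  have hXnn : ∀ a b, 0 ≤ X a b := fun a b => (hXK a trivial b trivial).1
  have hXeq : D x (-1) + D x 0 * X + D x 1 * X ^ 2 = X := by
    have hc : Continuous fun p : Matrix S S ℝ × Matrix S S ℝ × Matrix S S ℝ × Matrix S S ℝ =>
        p.1 + p.2.1 * p.2.2.2 + p.2.2.1 * p.2.2.2 ^ 2 := by fun_prop
    have ht : Tendsto (fun z => D z (-1) + D z 0 * gMatrix (D z) + D z 1 * gMatrix (D z) ^ 2) g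
        (𝓝 (D x (-1) + D x 0 * X + D x 1 * X ^ 2)) :=
      (hc.tendsto (D x (-1), D x 0, D x 1, X)).comp
        (((hcont (-1)).tendsto.mono_left hg).prodMk_nhds
          (((hcont 0).tendsto.mono_left hg).prodMk_nhds
            (((hcont 1).tendsto.mono_left hg).prodMk_nhds hX)))
    exact tendsto_nhds_unique ht (hX.congr' (hg (hmin.mono fun z hz => hz.2.1.symm)))
  have hle : ∀ a b, gMatrix (D x) a b ≤ X a b := hst.g_spec.1.2.2 X hXnn hXeq
  -- The bound holds for all small `ε`, each on its own neighbourhood of `x`; letting `ε → 0` after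
  -- the limit in `z` gives unit row sums as upper bound. With `G ≤ X` and `G` stochastic, `X = G`.
  have hX1 : ∀ a, (X *ᵥ 1) a ≤ 1 := fun a => by
    have hbound : ∀ᶠ ε in 𝓝[>] (0 : ℝ), (X *ᵥ (1 + ε • h)) a ≤ (1 + ε) * (1 + ε • h) a := by
      filter_upwards [hG] with ε hε
      have hc : Continuous fun M : Matrix S S ℝ => (M *ᵥ (1 + ε • h)) a := by fun_prop
      exact le_of_tendsto ((hc.tendsto X).comp hX) (hg (hε.2.mono fun z hz => hz.2 a))
    have c1 : Continuous fun ε : ℝ => (X *ᵥ (1 + ε • h)) a := by fun_prop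
    have c2 : Continuous fun ε : ℝ => (1 + ε) * (1 + ε • h) a := by fun_prop
    simpa using le_of_tendsto_of_tendsto ((c1.tendsto 0).mono_left nhdsWithin_le_nhds)
      ((c2.tendsto 0).mono_left nhdsWithin_le_nhds) hbound
  have hXG : X = gMatrix (D x) := by
    ext a b
    have hg1 := congrFun hst.g_mulVec_one a
    have hx1 := hX1 a
    simp only [Matrix.mulVec, dotProduct, Pi.one_apply, mul_one] at hg1 hx1
    have hs : ∑ b, gMatrix (D x) a b = ∑ b, X a b :=
      le_antisymm (Finset.sum_le_sum fun b _ => hle a b) (hx1.trans hg1.ge)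
    exact ((Finset.sum_eq_sum_iff_of_le fun b _ => hle a b).1 hs b (Finset.mem_univ b)).symm
  rw [hXG] at hX
  exact hX

/-- The derivative of the row sums of the G-matrix. -/
theorem hasDerivAt_gMatrix_mulVec_one {D' : ℤ → Matrix S S ℝ}
    (hnn : ∀ᶠ z in 𝓝 x, ∀ j ∈ stepH, ∀ a b, 0 ≤ D z j a b)
    (hD : ∀ j a b, HasDerivAt (fun z => D z j a b) (D' j a b) x)
    (h1 : D x (-1) *ᵥ 1 + D x 0 *ᵥ 1 + D x 1 *ᵥ 1 = 1)
    (hker : ∀ y, (D x (-1) + D x 0 + D x 1) *ᵥ y = y → ∃ c : ℝ, y = fun _ => c)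
    (hdrift : stationaryDistribution (D x (-1) + D x 0 + D x 1) ⬝ᵥ
      ((-D x (-1) + D x 1) *ᵥ 1) < 0) :
    HasDerivAt (fun z => gMatrix (D z) *ᵥ 1)
      ((1 - D x 0 - D x 1 - D x 1 * gMatrix (D x))⁻¹ *ᵥ
        ((D' (-1) + D' 0 + D' 1) *ᵥ 1)) x := by
  obtain ⟨w, ρ, v, hst⟩ := exists_stableTriplet hnn.self_of_nhds h1 hker hdrift
  have hcont : ∀ j, ContinuousAt (fun z => D z j) x := fun j =>
    continuousAt_of_forall_hasDerivAt (hD j)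
  obtain ⟨hmin, hG⟩ := continuousAt_gMatrix hnn hcont h1 hker hdrift
  set K : ℝ → Matrix S S ℝ := fun z => 1 - D z 0 - D z 1 - D z 1 * gMatrix (D z) with hK
  have hKc : ContinuousAt K x := by
    have hc : Continuous fun p : Matrix S S ℝ × Matrix S S ℝ × Matrix S S ℝ =>
        1 - p.1 - p.2.1 - p.2.1 * p.2.2 := by fun_prop
    exact hc.continuousAt.comp ((hcont 0).prodMk ((hcont 1).prodMk hG))
  have hdetc : ContinuousAt (fun z => (K z).det) x :=
    (Continuous.matrix_det continuous_id).continuousAt.comp hKc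
  have hadjc : ContinuousAt (fun z => (K z).adjugate) x :=
    (Continuous.matrix_adjugate continuous_id).continuousAt.comp hKc
  have hdet : (K x).det ≠ 0 := isUnit_iff_ne_zero.1 hst.isUnit_k
  have hinvc : ContinuousAt (fun z => (K z)⁻¹) x := by
    simp only [Matrix.inv_def, Ring.inverse_eq_inv']
    exact (hdetc.inv₀ hdet).smul hadjc
  set s : ℝ → S → ℝ := fun z => (D z (-1) + D z 0 + D z 1) *ᵥ 1 - 1 with hs
  have hsx : s x = 0 := by
    simp only [hs, Matrix.add_mulVec, h1, sub_self]
  have hsd : HasDerivAt s ((D' (-1) + D' 0 + D' 1) *ᵥ 1) x := by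
    have := (HasDerivAt.matrix_mulVec_pi (M := fun z => D z (-1) + D z 0 + D z 1)
      (M' := D' (-1) + D' 0 + D' 1) (fun a b => ((hD (-1) a b).add (hD 0 a b)).add (hD 1 a b))
      (hasDerivAt_const x (1 : S → ℝ))).sub_const 1
    simpa [hs] using this
  -- Near `x`, `G(z) 1 = 1 + K(z)⁻¹ s(z)` with `s x = 0`, so continuity of `K⁻¹` is enough.
  have key := (hasDerivAt_mulVec_of_eq_zero hinvc hsd hsx).const_add 1
  refine key.congr_of_eventuallyEq ?_
  filter_upwards [hmin, hdetc.eventually_ne hdet] with z hz hdz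
  have e0 : gMatrix (D z) *ᵥ 1 = D z (-1) *ᵥ 1 + D z 0 *ᵥ (gMatrix (D z) *ᵥ 1) +
      D z 1 *ᵥ (gMatrix (D z) *ᵥ (gMatrix (D z) *ᵥ 1)) := by
    have := hz.2.1
    conv_lhs => rw [← this]
    simp only [Matrix.add_mulVec, Matrix.mulVec_mulVec, sq]
  have e1 : K z *ᵥ (gMatrix (D z) *ᵥ 1 - 1) = s z := by
    simp only [hK, hs, Matrix.sub_mulVec, Matrix.add_mulVec, Matrix.mulVec_sub, Matrix.one_mulVec,
      ← Matrix.mulVec_mulVec]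
    nth_rewrite 1 [e0]
    abel
  rw [← e1, Matrix.mulVec_mulVec, Matrix.nonsing_inv_mul _ (isUnit_iff_ne_zero.2 hdz),
    Matrix.one_mulVec]
  abel

/-- The derivative of the Perron eigenvalue of the censored boundary block is a positive multiple
of the mean drift under the stationary distribution of the block tri-diagonal chain. -/
theorem exists_hasDerivAt_spr_censored {B : ℝ → ℤ → Matrix S S ℝ} {D' B' : ℤ → Matrix S S ℝ}
    (hDnn : ∀ᶠ z in 𝓝 x, ∀ j ∈ stepH, ∀ a b, 0 ≤ D z j a b)
    (hBnn : ∀ᶠ z in 𝓝 x, ∀ j ∈ stepHPlus, ∀ a b, 0 ≤ B z j a b)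
    (hD : ∀ j a b, HasDerivAt (fun z => D z j a b) (D' j a b) x)
    (hB : ∀ j a b, HasDerivAt (fun z => B z j a b) (B' j a b) x)
    (hD1 : D x (-1) *ᵥ 1 + D x 0 *ᵥ 1 + D x 1 *ᵥ 1 = 1) (hB1 : B x 0 *ᵥ 1 + B x 1 *ᵥ 1 = 1)
    (hker : ∀ y, (D x (-1) + D x 0 + D x 1) *ᵥ y = y → ∃ c : ℝ, y = fun _ => c)
    (hmax : ∀ y : ℕ → S → ℝ, y 0 = B x 0 *ᵥ y 0 + B x 1 *ᵥ y 1 →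
      (∀ k, y (k + 1) = D x (-1) *ᵥ y k + D x 0 *ᵥ y (k + 1) + D x 1 *ᵥ y (k + 2)) →
      ∀ a₀, (∀ k a, y k a ≤ y 0 a₀) → ∀ k a, y k a = y 0 a₀)
    (hdrift : stationaryDistribution (D x (-1) + D x 0 + D x 1) ⬝ᵥ
      ((-D x (-1) + D x 1) *ᵥ 1) < 0) :
    ∃ c : ℝ, 0 < c ∧ HasDerivAt (fun z => spr (B z 0 + B z 1 * gMatrix (D z)))
      (c * ((fun a => stationaryDistribution (blockTridiagonal (B x) (D x)) (0, a)) ⬝ᵥ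
          ((B' 0 + B' 1) *ᵥ 1) +
        ((fun a => stationaryDistribution (blockTridiagonal (B x) (D x)) (1, a)) ᵥ*
          (1 - rateMatrix (D x))⁻¹) ⬝ᵥ ((D' (-1) + D' 0 + D' 1) *ᵥ 1))) x := by
  obtain ⟨w, ρ, v, hst⟩ := exists_stableTriplet hDnn.self_of_nhds hD1 hker hdrift
  have hcont : ∀ j, ContinuousAt (fun z => D z j) x := fun j =>
    continuousAt_of_forall_hasDerivAt (hD j)
  have hcontB : ∀ j, ContinuousAt (fun z => B z j) x := fun j =>
    continuousAt_of_forall_hasDerivAt (hB j)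
  obtain ⟨hmin, hG⟩ := continuousAt_gMatrix hDnn hcont hD1 hker hdrift
  have hg := hasDerivAt_gMatrix_mulVec_one hDnn hD hD1 hker hdrift
  have hB0 : ∀ a b, 0 ≤ B x 0 a b := hBnn.self_of_nhds 0 (by simp [stepHPlus])
  have hB1' : ∀ a b, 0 ≤ B x 1 a b := hBnn.self_of_nhds 1 (by simp [stepHPlus])
  obtain ⟨hu, hp1, hpos⟩ := hst.stationary_form (stationaryDistribution_spec
    (hst.exists_isStationaryDistribution hB0 hB1' hB1))
  set π := stationaryDistribution (blockTridiagonal (B x) (D x))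
  set G := gMatrix (D x)
  set T := ∑ a, π (0, a) with hT
  set p₀ : S → ℝ := fun a => π (0, a) with hp₀
  have hnnC : ∀ᶠ z in 𝓝 x, ∀ a b, 0 ≤ (B z 0 + B z 1 * gMatrix (D z)) a b := by
    filter_upwards [hBnn, hmin] with z hz hm a b
    exact add_nonneg (hz 0 (by simp [stepHPlus]) a b)
      (mul_apply_nonneg (hz 1 (by simp [stepHPlus])) hm.1 a b)
  have hcC : ContinuousAt (fun z => B z 0 + B z 1 * gMatrix (D z)) x := by
    have hc : Continuous fun p : Matrix S S ℝ × Matrix S S ℝ × Matrix S S ℝ =>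
        p.1 + p.2.1 * p.2.2 := by fun_prop
    exact hc.continuousAt.comp ((hcontB 0).prodMk ((hcontB 1).prodMk hG))
  have hkerC : ∀ y, (B x 0 + B x 1 * gMatrix (D x)) *ᵥ y = y → ∃ c : ℝ, y = fun _ => c := by
    intro y hy
    obtain ⟨a₀, -, ha₀⟩ := Finset.exists_max_image Finset.univ y Finset.univ_nonempty
    have hGpow : ∀ k, G ^ (k + 1) *ᵥ y = G *ᵥ (G ^ k *ᵥ y) := fun k => by
      rw [pow_succ', Matrix.mulVec_mulVec]
    -- A fixed vector `y` of the censored matrix extends to the harmonic function `G ^ k y` on all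
    -- levels; as `G` is stochastic, its maximum is attained at level `0`.
    have := hmax (fun k => G ^ k *ᵥ y) (by
        rw [Matrix.add_mulVec, ← Matrix.mulVec_mulVec] at hy
        simpa using hy.symm) (fun k => by
        have := hst.g_mulVec (G ^ k *ᵥ y)
        rwa [← hGpow, ← hGpow] at this) a₀ (fun k a => by
        have h2 := mulVec_le_mulVec_of_nonneg (v := y) (w := y a₀ • 1)
          (pow_apply_nonneg hst.g_nonneg k) (fun a => by simpa using ha₀ a (Finset.mem_univ a)) a
        rw [Matrix.mulVec_smul, pow_mulVec_eq_self hst.g_mulVec_one] at h2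
        simpa using h2) 0
    exact ⟨y a₀, funext fun a => by simpa using this a⟩
  have hdC : HasDerivAt (fun z => (B z 0 + B z 1 * gMatrix (D z)) *ᵥ 1)
      ((B' 0 + B' 1) *ᵥ 1 + B x 1 *ᵥ ((1 - D x 0 - D x 1 - D x 1 * G)⁻¹ *ᵥ
        ((D' (-1) + D' 0 + D' 1) *ᵥ 1))) x := by
    have e1 := HasDerivAt.matrix_mulVec_pi (hB 0) (hasDerivAt_const x (1 : S → ℝ))
    have e2 := HasDerivAt.matrix_mulVec_pi (hB 1) hg
    refine ((e1.add e2).congr_deriv ?_).congr_of_eventuallyEq (Eventually.of_forall fun z => ?_)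
    · rw [hst.g_mulVec_one, Matrix.add_mulVec (B' 0), Matrix.mulVec_zero, add_zero, ← add_assoc]
    · simp [Matrix.add_mulVec, Matrix.mulVec_mulVec]
  have key := hasDerivAt_spr hnnC hcC (hst.censored_mulVec_one hB1) hkerC (u := T⁻¹ • p₀) (by
    simp only [Pi.smul_apply, smul_eq_mul, ← Finset.mul_sum]
    exact inv_mul_cancel₀ hpos.ne') (by rw [Matrix.smul_vecMul, hu]) hdC
  refine ⟨T⁻¹, inv_pos.2 hpos, key.congr_deriv ?_⟩
  -- Here `π₁ (1 - R)⁻¹ = π₀ B₁ N (1 - R)⁻¹ = π₀ B₁ K⁻¹`, matching the derivative of the row sums.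
  rw [smul_dotProduct, smul_eq_mul, dotProduct_add, hp1, Matrix.vecMul_vecMul, Matrix.mul_assoc,
    hst.n_mul_one_sub_rateMatrix_inv, ← Matrix.dotProduct_mulVec p₀, Matrix.mulVec_mulVec]

end Perturbation

/-! ### Irreducibility expressed through closed sets -/

section Irreducibility

/-- The only nonempty closed set of states is the whole state space. -/
def OnlyTrivialClosedSet {X : Type*} (p : Matrix X X ℝ) : Prop :=
  ∀ M : Set X, M.Nonempty → (∀ x ∈ M, ∀ y, 0 < p x y → y ∈ M) → ∀ y, y ∈ M

/-- A positive `n`-step probability forces a path of positive one-step transitions, which cannot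
leave a closed set. -/
theorem ChainIrreducible.onlyTrivialClosedSet {X : Type*} [DecidableEq X] {p : Matrix X X ℝ}
    (h : ChainIrreducible p) (h0 : ∀ x y, 0 ≤ p x y) : OnlyTrivialClosedSet p := by
  intro M ⟨x, hx⟩ hM y
  have hnn : ∀ n x y, 0 ≤ nStep p n x y := by
    intro n
    induction n with
    | zero => intro x y; simp only [nStep, Matrix.one_apply]; split_ifs <;> norm_num
    | succ n ih => exact fun x y => tsum_nonneg fun w => mul_nonneg (h0 x w) (ih w y)
  have key : ∀ n, ∀ x ∈ M, 0 < nStep p n x y → y ∈ M := by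
    intro n
    induction n with
    | zero =>
      intro x hx hpos
      simp only [nStep, Matrix.one_apply] at hpos
      split_ifs at hpos with hxy
      · exact hxy ▸ hx
      · exact absurd hpos (lt_irrefl _)
    | succ n ih =>
      intro x hx hpos
      obtain ⟨w, hw⟩ : ∃ w, p x w * nStep p n w y ≠ 0 := by
        by_contra hcon
        push Not at hcon
        simp [nStep, hcon] at hpos
      exact ih w (hM x hx w ((h0 x w).lt_of_ne fun e => hw (by rw [← e, zero_mul])))
        ((hnn n w y).lt_of_ne fun e => hw (by rw [← e, mul_zero]))
  obtain ⟨n, hn⟩ := h x y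
  exact key n x hx hn

theorem OnlyTrivialClosedSet.of_equiv {X Y : Type*} {p : Matrix X X ℝ} {q : Matrix Y Y ℝ}
    (e : X ≃ Y) (h : OnlyTrivialClosedSet q) (hpq : ∀ x y, p x y = q (e x) (e y)) :
    OnlyTrivialClosedSet p := by
  intro M ⟨x, hx⟩ hM y
  have := h (e.symm ⁻¹' M) ⟨e x, by simpa using hx⟩ (fun z hz w hzw =>
    hM (e.symm z) hz (e.symm w) (by rw [hpq]; simpa using hzw)) (e y)
  simpa using this

theorem eq_zero_of_mulVec_eq_zero {S : Type*} [Fintype S] {M : Matrix S S ℝ}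
    (hM : ∀ a b, 0 ≤ M a b) {g : S → ℝ} (hg : ∀ a, 0 ≤ g a) {a b : S} (h : (M *ᵥ g) a = 0)
    (hab : 0 < M a b) : g b = 0 := by
  have := (Finset.sum_eq_zero_iff_of_nonneg fun c _ => mul_nonneg (hM a c) (hg c)).1 h b
    (Finset.mem_univ b)
  exact (mul_eq_zero.1 this).resolve_left hab.ne'

end Irreducibility

/-! ### Application to the two-dimensional process -/

namespace TwoDQBD

open Filter Topology

variable {S : Type*} [Fintype S] [DecidableEq S] (Q : TwoDQBD S)

/-- The process with the two coordinates exchanged. -/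
def swap : TwoDQBD S where
  A i j := Q.A j i
  A₁ i j := Q.A₂ j i
  A₂ i j := Q.A₁ j i
  A₀ i j := Q.A₀ j i
  A_nonneg i hi j hj := Q.A_nonneg j hj i hi
  A₁_nonneg i hi j hj := Q.A₂_nonneg j hj i hi
  A₂_nonneg i hi j hj := Q.A₁_nonneg j hj i hi
  A₀_nonneg i hi j hj := Q.A₀_nonneg j hj i hi
  A_stochastic a := by rw [Finset.sum_comm]; exact Q.A_stochastic a
  A₁_stochastic a := by rw [Finset.sum_comm]; exact Q.A₂_stochastic a
  A₂_stochastic a := by rw [Finset.sum_comm]; exact Q.A₁_stochastic a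
  A₀_stochastic a := by rw [Finset.sum_comm]; exact Q.A₀_stochastic a

theorem PTilde_nonneg (x y : ℤ × ℤ × S) : 0 ≤ Q.PTilde x y := by
  simp only [PTilde]
  split_ifs with h
  · exact Q.A_nonneg _ h.1 _ h.2 _ _
  · exact le_rfl

theorem PTilde₁_nonneg (x y : ℤ × ℕ × S) : 0 ≤ Q.PTilde₁ x y := by
  simp only [PTilde₁]
  split_ifs with h1 h2 h2
  · exact Q.A_nonneg _ h2.1 _ h2.2 _ _
  · exact le_rfl
  · exact Q.A₁_nonneg _ h2.1 _ h2.2 _ _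
  · exact le_rfl

theorem PTilde₂_nonneg (x y : ℕ × ℤ × S) : 0 ≤ Q.PTilde₂ x y := by
  simp only [PTilde₂]
  split_ifs with h1 h2 h2
  · exact Q.A_nonneg _ h2.1 _ h2.2 _ _
  · exact le_rfl
  · exact Q.A₂_nonneg _ h2.1 _ h2.2 _ _
  · exact le_rfl

theorem swap_PTilde_onlyTrivialClosedSet (h : OnlyTrivialClosedSet Q.PTilde) :
    OnlyTrivialClosedSet Q.swap.PTilde :=
  h.of_equiv ⟨fun x => (x.2.1, x.1, x.2.2), fun x => (x.2.1, x.1, x.2.2), fun _ => rfl,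
    fun _ => rfl⟩ fun x y => by simp only [PTilde, swap, Equiv.coe_fn_mk, and_comm]

theorem swap_PTilde₁_onlyTrivialClosedSet (h : OnlyTrivialClosedSet Q.PTilde₂) :
    OnlyTrivialClosedSet Q.swap.PTilde₁ :=
  h.of_equiv ⟨fun x => (x.2.1, x.1, x.2.2), fun x => (x.2.1, x.1, x.2.2), fun _ => rfl,
    fun _ => rfl⟩ fun x y => by simp only [PTilde₁, PTilde₂, swap, Equiv.coe_fn_mk, and_comm]

theorem swap_drift12₂ : Q.swap.drift12₂ = Q.drift12₁ := by
  have : Q.swap.Astar = Q.Astar := Finset.sum_comm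
  simp only [drift12₂, drift12₁, this]
  rfl

theorem sum_stepH {M : Type*} [AddCommMonoid M] (f : ℤ → M) :
    ∑ i ∈ stepH, f i = f (-1) + (f 0 + f 1) := by
  simp [stepH]

theorem sum_stepHPlus {M : Type*} [AddCommMonoid M] (f : ℤ → M) :
    ∑ i ∈ stepHPlus, f i = f 0 + f 1 := by
  simp [stepHPlus]

theorem Astar_eq : Q.Astar = Q.colA 1 (-1) + Q.colA 1 0 + Q.colA 1 1 := by
  simp only [Astar, colA, sum_stepH, one_zpow, one_smul]
  abel

theorem Astar_mulVec_one : Q.Astar *ᵥ 1 = 1 :=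
  funext fun a => by simpa [Matrix.mulVec, dotProduct, Astar] using Q.A_stochastic a

theorem colA₁_mulVec_one : Q.colA₁ 1 0 *ᵥ 1 + Q.colA₁ 1 1 *ᵥ 1 = 1 := by
  rw [← Matrix.add_mulVec]
  have e : Q.colA₁ 1 0 + Q.colA₁ 1 1 = ∑ i ∈ stepH, ∑ j ∈ stepHPlus, Q.A₁ i j := by
    simp only [colA₁, sum_stepH, sum_stepHPlus, one_zpow, one_smul]
    abel
  rw [e]
  exact funext fun a => by simpa [Matrix.mulVec, dotProduct] using Q.A₁_stochastic a

theorem colA_nonneg {z : ℝ} (hz : 0 < z) {j : ℤ} (hj : j ∈ stepH) (a b : S) :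
    0 ≤ Q.colA z j a b := by
  rw [colA, Matrix.sum_apply]
  exact Finset.sum_nonneg fun i hi => mul_nonneg (zpow_pos hz i).le (Q.A_nonneg i hi j hj a b)

theorem colA₁_nonneg {z : ℝ} (hz : 0 < z) {j : ℤ} (hj : j ∈ stepHPlus) (a b : S) :
    0 ≤ Q.colA₁ z j a b := by
  rw [colA₁, Matrix.sum_apply]
  exact Finset.sum_nonneg fun i hi => mul_nonneg (zpow_pos hz i).le (Q.A₁_nonneg i hi j hj a b)

theorem A_le_colA {i j : ℤ} (hi : i ∈ stepH) (hj : j ∈ stepH) (a b : S) :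
    Q.A i j a b ≤ Q.colA 1 j a b := by
  simp only [colA, Matrix.sum_apply, one_zpow, one_smul]
  exact Finset.single_le_sum (f := fun i => Q.A i j a b)
    (fun i hi => Q.A_nonneg i hi j hj a b) hi

theorem A₁_le_colA₁ {i j : ℤ} (hi : i ∈ stepH) (hj : j ∈ stepHPlus) (a b : S) :
    Q.A₁ i j a b ≤ Q.colA₁ 1 j a b := by
  simp only [colA₁, Matrix.sum_apply, one_zpow, one_smul]
  exact Finset.single_le_sum (f := fun i => Q.A₁ i j a b)
    (fun i hi => Q.A₁_nonneg i hi j hj a b) hi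

theorem hasDerivAt_sum_stepH (f : ℤ → ℝ) :
    HasDerivAt (fun z : ℝ => ∑ i ∈ stepH, z ^ i * f i) (f 1 - f (-1)) 1 := by
  have h := fun i : ℤ => (hasDerivAt_zpow i (1 : ℝ) (Or.inl one_ne_zero)).mul_const (f i)
  refine (HasDerivAt.fun_sum (u := stepH) fun i _ => h i).congr_deriv ?_
  rw [sum_stepH]
  simp
  ring

theorem hasDerivAt_colA (j : ℤ) (a b : S) :
    HasDerivAt (fun z => Q.colA z j a b) ((Q.A 1 j - Q.A (-1) j) a b) 1 := by
  simpa [colA, Matrix.sum_apply] using hasDerivAt_sum_stepH fun i => Q.A i j a b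

theorem hasDerivAt_colA₁ (j : ℤ) (a b : S) :
    HasDerivAt (fun z => Q.colA₁ z j a b) ((Q.A₁ 1 j - Q.A₁ (-1) j) a b) 1 := by
  simpa [colA₁, Matrix.sum_apply] using hasDerivAt_sum_stepH fun i => Q.A₁ i j a b

/-- The gap `g` between the maximum and `y` is nonnegative and harmonic, so its zeros spread along
transitions. Lifted to `ℤ × ℕ × S`, constant in the first coordinate, its zero set is closed and
nonempty. -/
theorem harmonic_eq_const_of_max (hP : OnlyTrivialClosedSet Q.PTilde₁) (y : ℕ → S → ℝ)
    (h0 : y 0 = Q.colA₁ 1 0 *ᵥ y 0 + Q.colA₁ 1 1 *ᵥ y 1)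
    (h : ∀ k, y (k + 1) =
      Q.colA 1 (-1) *ᵥ y k + Q.colA 1 0 *ᵥ y (k + 1) + Q.colA 1 1 *ᵥ y (k + 2))
    (a₀ : S) (hmax : ∀ k a, y k a ≤ y 0 a₀) (k : ℕ) (a : S) : y k a = y 0 a₀ := by
  set m := y 0 a₀
  let g : ℕ → S → ℝ := fun k => m • 1 - y k
  have hg : ∀ k a, g k a = m - y k a := fun k a => by simp [g]
  have hg0 : ∀ k a, 0 ≤ g k a := fun k a => by rw [hg]; exact sub_nonneg.2 (hmax k a)
  have hA := Q.Astar_mulVec_one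
  rw [Astar_eq, Matrix.add_mulVec, Matrix.add_mulVec] at hA
  have e0 : g 0 = Q.colA₁ 1 0 *ᵥ g 0 + Q.colA₁ 1 1 *ᵥ g 1 := by
    refine (congrArg₂ (· - ·) (congrArg (m • ·) Q.colA₁_mulVec_one.symm) h0).trans ?_
    simp only [g, Matrix.mulVec_sub, Matrix.mulVec_smul, smul_add]
    abel
  have e1 : ∀ k, g (k + 1) =
      Q.colA 1 (-1) *ᵥ g k + Q.colA 1 0 *ᵥ g (k + 1) + Q.colA 1 1 *ᵥ g (k + 2) := fun k => by
    refine (congrArg₂ (· - ·) (congrArg (m • ·) hA.symm) (h k)).trans ?_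
    simp only [g, Matrix.mulVec_sub, Matrix.mulVec_smul, smul_add]
    abel
  have hD := fun {j : ℤ} (hj : j ∈ stepH) => Q.colA_nonneg one_pos hj
  have hB := fun {j : ℤ} (hj : j ∈ stepHPlus) => Q.colA₁_nonneg one_pos hj
  have hclosed := hP {x | g x.2.1 x.2.2 = 0} ⟨(0, 0, a₀), by simp [hg, m]⟩ (by
    rintro ⟨i, k, a⟩ hx ⟨i', k', b⟩ hpos
    simp only [Set.mem_ofPred_eq] at hx ⊢
    simp only [PTilde₁] at hpos
    cases k with
    | zero =>
      simp only [ne_eq, not_true_eq_false, if_false] at hpos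
      split_ifs at hpos with hδ
      swap; · exact absurd hpos (lt_irrefl _)
      have hlt := hpos.trans_le (Q.A₁_le_colA₁ hδ.1 hδ.2 a b)
      have hz := congrFun e0 a
      rw [hx, Pi.add_apply] at hz
      have n0 := mulVec_apply_nonneg (hB (j := 0) (by simp [stepHPlus])) (hg0 0) a
      have n1 := mulVec_apply_nonneg (hB (j := 1) (by simp [stepHPlus])) (hg0 1) a
      have hj := hδ.2
      simp only [stepHPlus, Finset.mem_insert, Finset.mem_singleton] at hj
      rcases hj with hj | hj <;> rw [hj] at hlt
      · obtain rfl : k' = 0 := by omega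
        exact eq_zero_of_mulVec_eq_zero (hB (by simp [stepHPlus])) (hg0 0) (by linarith) hlt
      · obtain rfl : k' = 1 := by omega
        exact eq_zero_of_mulVec_eq_zero (hB (by simp [stepHPlus])) (hg0 1) (by linarith) hlt
    | succ k =>
      simp only [ne_eq, Nat.add_eq_zero_iff, one_ne_zero, and_false, not_false_eq_true,
        if_true] at hpos
      split_ifs at hpos with hδ
      swap; · exact absurd hpos (lt_irrefl _)
      have hlt := hpos.trans_le (Q.A_le_colA hδ.1 hδ.2 a b)
      have hz := congrFun (e1 k) a
      rw [hx, Pi.add_apply, Pi.add_apply] at hz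
      have n0 := mulVec_apply_nonneg (hD (j := -1) (by simp [stepH])) (hg0 k) a
      have n1 := mulVec_apply_nonneg (hD (j := 0) (by simp [stepH])) (hg0 (k + 1)) a
      have n2 := mulVec_apply_nonneg (hD (j := 1) (by simp [stepH])) (hg0 (k + 2)) a
      have hj := hδ.2
      simp only [stepH, Finset.mem_insert, Finset.mem_singleton] at hj
      rcases hj with hj | hj | hj <;> rw [hj] at hlt
      · obtain rfl : k' = k := by omega
        exact eq_zero_of_mulVec_eq_zero (hD (by simp [stepH])) (hg0 _) (by linarith) hlt
      · obtain rfl : k' = k + 1 := by omega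
        exact eq_zero_of_mulVec_eq_zero (hD (by simp [stepH])) (hg0 _) (by linarith) hlt
      · obtain rfl : k' = k + 2 := by omega
        exact eq_zero_of_mulVec_eq_zero (hD (by simp [stepH])) (hg0 _) (by linarith) hlt)
    (0, k, a)
  have : g k a = 0 := hclosed
  rw [hg] at this
  linarith

/-- The same maximum principle, with the gap lifted to `ℤ × ℤ × S` through the phase alone. -/
theorem Astar_eq_const_of_fixed [Nonempty S] (hP : OnlyTrivialClosedSet Q.PTilde) (x : S → ℝ)
    (hx : Q.Astar *ᵥ x = x) : ∃ c : ℝ, x = fun _ => c := by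
  obtain ⟨a₀, -, ha₀⟩ := Finset.exists_max_image Finset.univ x Finset.univ_nonempty
  have hAnn : ∀ a b, 0 ≤ Q.Astar a b := fun a b => by
    simp only [Astar, Matrix.sum_apply]
    exact Finset.sum_nonneg fun i hi => Finset.sum_nonneg fun j hj => Q.A_nonneg i hi j hj a b
  let g : S → ℝ := x a₀ • 1 - x
  have hg : ∀ a, g a = x a₀ - x a := fun a => by simp [g]
  have hg0 : ∀ a, 0 ≤ g a := fun a => by
    rw [hg]; exact sub_nonneg.2 (ha₀ a (Finset.mem_univ a))
  have hfix : Q.Astar *ᵥ g = g := by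
    simp only [g, Matrix.mulVec_sub, Matrix.mulVec_smul, Q.Astar_mulVec_one, hx]
  have hclosed := hP {y | g y.2.2 = 0} ⟨(0, 0, a₀), by simp [hg]⟩ (by
    rintro ⟨i, j, a⟩ hy ⟨i', j', b⟩ hpos
    simp only [Set.mem_ofPred_eq] at hy ⊢
    simp only [PTilde] at hpos
    split_ifs at hpos with hδ
    swap; · exact absurd hpos (lt_irrefl _)
    refine eq_zero_of_mulVec_eq_zero hAnn hg0 ((congrFun hfix a).trans hy) (hpos.trans_le ?_)
    simp only [Astar, Matrix.sum_apply]
    exact (Finset.single_le_sum (f := fun j => Q.A (i' - i) j a b)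
      (fun j hj => Q.A_nonneg _ hδ.1 j hj a b) hδ.2).trans
      (Finset.single_le_sum (f := fun i => ∑ j ∈ stepH, Q.A i j a b)
        (fun i hi => Finset.sum_nonneg fun j hj => Q.A_nonneg i hi j hj a b) hδ.1))
  refine ⟨x a₀, funext fun a => ?_⟩
  have : g a = 0 := hclosed (0, 0, a)
  rw [hg] at this
  linarith

theorem exists_hasDerivAt_ψ₁ [Nonempty S] (hP : OnlyTrivialClosedSet Q.PTilde)
    (hP₁ : OnlyTrivialClosedSet Q.PTilde₁) (hdrift : Q.drift12₂ < 0) :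
    ∃ c : ℝ, 0 < c ∧ HasDerivAt Q.ψ₁ (c * Q.drift1₁) 1 := by
  have hpos : ∀ᶠ z in 𝓝 (1 : ℝ), 0 < z := eventually_gt_nhds one_pos
  have hA := Q.Astar_mulVec_one
  rw [Astar_eq, Matrix.add_mulVec, Matrix.add_mulVec] at hA
  obtain ⟨c, hc, h⟩ := exists_hasDerivAt_spr_censored (D := Q.colA) (B := Q.colA₁)
    (hpos.mono fun z hz j hj => Q.colA_nonneg hz hj)
    (hpos.mono fun z hz j hj => Q.colA₁_nonneg hz hj)
    Q.hasDerivAt_colA Q.hasDerivAt_colA₁ hA Q.colA₁_mulVec_one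
    (by rw [← Astar_eq]; exact Q.Astar_eq_const_of_fixed hP) (Q.harmonic_eq_const_of_max hP₁)
    (by rw [← Astar_eq]; exact hdrift)
  refine ⟨c, hc, h.congr_deriv ?_⟩
  have e1 : Q.A₁ 1 0 - Q.A₁ (-1) 0 + (Q.A₁ 1 1 - Q.A₁ (-1) 1) =
      -Q.A₁ (-1) 0 - Q.A₁ (-1) 1 + Q.A₁ 1 0 + Q.A₁ 1 1 := by abel
  -- Differentiating `z ^ i` at `1` leaves the blocks `i = 1` minus `i = -1`; summing over `j`
  -- regroups columns into rows.
  have e2 : Q.A 1 (-1) - Q.A (-1) (-1) + (Q.A 1 0 - Q.A (-1) 0) + (Q.A 1 1 - Q.A (-1) 1) =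
      -Q.rowA 1 (-1) + Q.rowA 1 1 := by
    simp only [rowA, sum_stepH, one_zpow, one_smul]
    abel
  rw [e1, e2]
  rfl

end TwoDQBD

end

theorem lemma2p5 {S : Type*} [Fintype S] [DecidableEq S] [Nonempty S] (Q : TwoDQBD S)
    (hQ : Q.UnboundedIrreducibleAperiodic) :
    (Q.drift12₂ < 0 → ∃ c₁ : ℝ, 0 < c₁ ∧ HasDerivAt Q.ψ₁ (c₁ * Q.drift1₁) 1) ∧
    (Q.drift12₁ < 0 → ∃ c₂ : ℝ, 0 < c₂ ∧ HasDerivAt Q.ψ₂ (c₂ * Q.drift2₂) 1) := by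
  obtain ⟨⟨hP, -⟩, ⟨hP₁, -⟩, ⟨hP₂, -⟩⟩ := hQ
  have h := hP.onlyTrivialClosedSet Q.PTilde_nonneg
  have h₁ := hP₁.onlyTrivialClosedSet Q.PTilde₁_nonneg
  have h₂ := hP₂.onlyTrivialClosedSet Q.PTilde₂_nonneg
  refine ⟨Q.exists_hasDerivAt_ψ₁ h h₁, fun hd => ?_⟩
  -- For the swapped process `ψ₁` and `drift1₁` unfold to `ψ₂` and `drift2₂`; only `Astar` needs its
  -- double sum reordered.
  exact Q.swap.exists_hasDerivAt_ψ₁ (Q.swap_PTilde_onlyTrivialClosedSet h)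
    (Q.swap_PTilde₁_onlyTrivialClosedSet h₂) (Q.swap_drift12₂ ▸ hd)
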